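/- Let $N\ge 1$ and $\mathsf B_N=\{-1,1\}^N$. A matrix $\rho\in\mathbb R^{N\times N}$ is called a *unit covariance* if there is a random vector $X$ with values in $\mathsf B_N$ such that $\rho_{ij}=\mathbf E[X_iX_j]$ for all $1\le i,j\le N$; let $\mathcal U_N$ be the set of unit covariances. Let $\mathcal U_N^*=\{(\rho_{ij})_{1\le i<j\le N}:\rho\in\mathcal U_N\}\subset\mathbb R^{N(N-1)/2}$ be the polytope of their supra-diagonal parts, and write $v\oslash v=(v_iv_j)_{1\le i<j\le N}$ for $v\in\mathbb R^N$. A vector $\mu\ne0$ is an *outer normal* of a facet of $\mathcal U_N^*$ if, for some $o\in\mathbb R$, one has $\langle x,\mu\rangle\le o$ for all $x\in\mathcal U_N^*$, and the set $\{x\in\mathcal U_N^*:\langle x,\mu\rangle=o\}$ is non-empty and has affine dimension $N(N-1)/2-1$. Finally let $$\mathsf E_N=\Big\{e\in\mathbb Z^N:\ \sum_{i=1}^N u_ie_i=1\text{ for some }u\in\mathsf B_N\Big\}.$$ (i) Suppose $N\le 6$. Then every outer normal $\mu$ of a facet of $\mathcal U_N^*$ is of the form $\mu=-c\,(e\oslash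 e)$ with $e\in\mathsf E_N$ and $c>0$ (that is, up to a positive factor, the corresponding inward normal $-\mu$ has the product form $e\oslash e$). Moreover, a symmetric matrix $\rho\in\mathbb R^{N\times N}$ with $\rho_{ii}=1$ for all $i$ is a unit covariance if and only if $$\sum_{i,j=1}^N\rho_{ij}e_ie_j\ \ge\ 1\qquad(\ast)$$ for every $e\in\mathsf E_N$. (ii) For every $N\ge1$, every unit covariance $\rho\in\mathcal U_N$ satisfies $(\ast)$ for all $e\in\mathbb Z^N$ such that $\sum_i e_i$ is odd. -/

import Mathlib

open MeasureTheory

/-- The set `B_N = {-1, 1}^N` of binary (sign) vectors. -/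
def signVectors (N : ℕ) : Set (Fin N → ℝ) :=
  {u | ∀ i, u i = -1 ∨ u i = 1}

/-- A unit field on `{1, …, N}`: a random vector all of whose values are sign vectors. -/
structure IsUnitField {Ω : Type*} [MeasurableSpace Ω] {N : ℕ} (X : Ω → Fin N → ℝ) : Prop where
  measurable : Measurable X
  mem_signVectors : ∀ ω, X ω ∈ signVectors N

/-- The set `U_N` of (realisable) unit covariances: the matrices `(E[X_i X_j])_{i,j}` of unit
fields `X` defined on some probability space. -/
def unitCovariances (N : ℕ) : Set (Matrix (Fin N) (Fin N) ℝ) :=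
  {ρ | ∃ (Ω : Type) (_ : MeasurableSpace Ω) (P : Measure Ω) (X : Ω → Fin N → ℝ),
    IsProbabilityMeasure P ∧ IsUnitField X ∧ ∀ i j, ρ i j = ∫ ω, X ω i * X ω j ∂P}

/-- Index set of the supra-diagonal entries: pairs `(i, j)` with `i < j`. -/
abbrev UpperPair (N : ℕ) : Type := {p : Fin N × Fin N // p.1 < p.2}

/-- The space `F_N^*` of supra-diagonal triangular arrays; its dimension is `N (N - 1) / 2`. -/
abbrev TriArray (N : ℕ) : Type := UpperPair N → ℝ

/-- The projection `π` of a matrix onto its supra-diagonal entries. -/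
def supraDiag {N : ℕ} (ρ : Matrix (Fin N) (Fin N) ℝ) : TriArray N :=
  fun p => ρ p.1.1 p.1.2

/-- The triangular array `v ⊘ v = (v_i v_j)_{i < j}`. -/
def triProd {N : ℕ} (v : Fin N → ℝ) : TriArray N :=
  supraDiag (Matrix.vecMulVec v v)

/-- The polytope `U_N^* = π(U_N)`. -/
def unitPolytope (N : ℕ) : Set (TriArray N) :=
  supraDiag '' unitCovariances N

/-- `μ` is an outer normal of a facet of the convex set `C` in `ℝ^ι`: `μ ≠ 0`, and for some offset
`o` the half-space `{x | ⟨x, μ⟩ ≤ o}` contains `C` while its boundary hyperplane meets `C` in a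
non-empty set of affine dimension one less than the dimension of `ℝ^ι`. -/
def IsFacetOuterNormal {ι : Type*} [Fintype ι] (C : Set (ι → ℝ)) (μ : ι → ℝ) : Prop :=
  μ ≠ 0 ∧ ∃ o : ℝ, (∀ x ∈ C, x ⬝ᵥ μ ≤ o) ∧ {x ∈ C | x ⬝ᵥ μ = o}.Nonempty ∧
    Module.finrank ℝ (affineSpan ℝ {x ∈ C | x ⬝ᵥ μ = o}).direction + 1 = Fintype.card ι

/-- The set `E_N` of the integer vectors `e` such that `∑ u_i e_i = 1` for some sign vector `u`. -/
def matheronVectors (N : ℕ) : Set (Fin N → ℤ) :=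
  {e | ∃ u ∈ signVectors N, ∑ i, u i * (e i : ℝ) = 1}

/-- The inequality `∑_{i,j} ρ_ij e_i e_j ≥ 1`. -/
def MatheronIneq {N : ℕ} (ρ : Matrix (Fin N) (Fin N) ℝ) (e : Fin N → ℤ) : Prop :=
  1 ≤ ∑ i, ∑ j, ρ i j * (e i : ℝ) * (e j : ℝ)

/-! On sign vectors `u_i² = 1`, so a diagonal entry can carry a constant: an affine inequality valid
on the polytope is the same thing as a quadratic form that is nonnegative on sign vectors
(`affineMatrix`). For odd `∑ e_i` the integer `e · u` is odd, hence `(e · u)² ≥ 1`; taking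
expectations gives part (ii), and with it the necessity of (∗).

The rest of part (i) rests on `HasZeroCover`: the zeros of a nonnegative form, if it is neither
zero-free nor identically zero on sign vectors, lie among those of some nontrivial `(e · u)² - 1`
with `e` in `E_N`. For a facet, this form then vanishes on the face as well, and codimension one
makes `e ⊘ e` proportional to `μ` (`exists_of_isFacetOuterNormal`). For sufficiency, multiples of
such forms and of the constant `1` are subtracted until the form vanishes on all sign vectors, so
every valid inequality follows from (∗) (`pairing_nonneg`); Hahn–Banach separation concludes.

`HasZeroCover` descends from `N + 1` to `N`, so `N = 6` suffices. A counterexample there is an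
`IsReducedForm`. Its zero set is a proper subset of the 32 antipodal pairs of sign vectors, closed
under the implications forced by linear relations between values of quadratic forms, and it
contains, for each `e` whose absolute values are a permutation of `(1,1,1,0,0,0)`, `(1,1,1,1,1,0)`
or `(2,1,1,1,1,1)`, a point with `(e · u)² ≠ 1`. A verified backtracking search, run after symmetry
reduction, shows that no such set exists (`not_isReducedForm`). -/

/-! ### A search procedure on bit masks -/

/-- `k n`, with `n` evaluated to a numeral first, which keeps kernel reduction sharp. -/
def withLit {α : Type} (n : ℕ) (k : ℕ → α) : α :=
  Nat.rec (motive := fun _ => α) (k 0) (fun m _ => k (Nat.succ m)) n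

theorem withLit_eq {α : Type} (n : ℕ) (k : ℕ → α) : withLit n k = k n := by
  cases n <;> rfl

/-- The mask of the highest bit of `n`. -/
def topBit (n : ℕ) : ℕ := Nat.pow 2 (Nat.log2 n)

/-- The number of bits of `n` below position `6`. -/
def weightSix (n : ℕ) : ℕ :=
  n % 2 + n / 2 % 2 + n / 4 % 2 + n / 8 % 2 + n / 16 % 2 + n / 32 % 2

/-- The number of bits of `n` below position `36`. -/
def weightThirtySix (n : ℕ) : ℕ :=
  weightSix n + weightSix (n / 64) + weightSix (n / 4096) + weightSix (n / 262144) +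
    weightSix (n / 16777216) + weightSix (n / 1073741824)

/-- A list of implications `A ⟹ B` between bit masks: if all bits of `A` are good, then so are all
bits of `B`. -/
inductive RuleList : Type
  | nil : RuleList
  | cons (A B : ℕ) (t : RuleList) : RuleList

local notation "ifb " b " then " x " else " y => Bool.rec (motive := fun _ => Bool) y x b

/-- One pass of unit propagation through the rules in `l`. Here `T` and `F` are the masks of the bits
known to be good and bad; rules that are still undecided are pushed onto `acc`. -/
noncomputable def passRules (l : RuleList) :
    ℕ → ℕ → RuleList → (ℕ → ℕ → RuleList → Bool) → Bool :=
  RuleList.rec (motive := fun _ => ℕ → ℕ → RuleList → (ℕ → ℕ → RuleList → Bool) → Bool)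
    (fun T F acc k => k T F acc)
    (fun A B _ ih T F acc k =>
      ifb Nat.beq (Nat.land A F) 0 then
        ifb Nat.beq (Nat.land B T) B then ih T F acc k
        else withLit (Nat.xor A (Nat.land A T)) fun r =>
          ifb Nat.beq r 0 then withLit (Nat.lor T B) fun T' => ih T' F acc k
          else ifb Nat.beq (Nat.land B F) 0 then ih T F (RuleList.cons A B acc) k
          else ifb Nat.beq (topBit r) r then withLit (Nat.lor F r) fun F' => ih T F' acc k
          else ih T F (RuleList.cons A B acc) k
      else ih T F acc k) l

/-- One pass of unit propagation through a list of masks each of which has a good bit. -/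
def passHits (l : List ℕ) : ℕ → ℕ → List ℕ → (ℕ → List ℕ → Bool) → Bool :=
  List.rec (motive := fun _ => ℕ → ℕ → List ℕ → (ℕ → List ℕ → Bool) → Bool)
    (fun T _ acc k => k T acc)
    (fun P _ ih T F acc k =>
      ifb Nat.beq (Nat.land P T) 0 then
        withLit (Nat.xor P (Nat.land P F)) fun r =>
          ifb Nat.beq r 0 then true
          else ifb Nat.beq (topBit r) r then withLit (Nat.lor T r) fun T' => ih T' F acc k
          else ih T F (r :: acc) k
      else ih T F acc k) l

/-- Passes a mask of least weight in `P :: l` to the continuation, where `c` is the weight of `P`. -/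
def minHit (l : List ℕ) : ℕ → ℕ → (ℕ → Bool) → Bool :=
  List.rec (motive := fun _ => ℕ → ℕ → (ℕ → Bool) → Bool)
    (fun P _ k => k P)
    (fun Q _ ih P c k => withLit (weightThirtySix Q) fun d =>
      ifb Nat.ble c d then ih P c k else ih Q d k) l

/-- Some bit is both good and bad, or the first `32` bits are all good. -/
def clash (T F : ℕ) : Bool :=
  ifb Nat.beq (Nat.land T F) 0 then Nat.beq T 4294967295 else true

/-- Backtracking search with unit propagation. The value `true` certifies that there is no set of
good bits, missing one of the first `32`, that contains `T`, avoids `F`, is closed under the rules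
`rs` and meets every mask in `hs` as well as `P` (if `P` is not `0`). -/
noncomputable def search (n : ℕ) : ℕ → ℕ → ℕ → RuleList → List ℕ → Bool :=
  Nat.rec (motive := fun _ => ℕ → ℕ → ℕ → RuleList → List ℕ → Bool)
    (fun _ _ _ _ _ => false)
    (fun _ ih T F P rs hs =>
      ifb Nat.beq P 0 then
        passRules rs T F RuleList.nil fun T₁ F₁ rs₁ =>
          ifb clash T₁ F₁ then true
          else passHits hs T₁ F₁ [] fun T₂ hs₂ =>
            ifb clash T₂ F₁ then true
            else ifb (ifb Nat.beq T T₂ then Nat.beq F F₁ else false) then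
              List.rec (motive := fun _ => Bool) false (fun Q t _ =>
                minHit t Q (weightThirtySix Q) fun Q' => ih T₂ F₁ Q' rs₁ hs₂) hs₂
            else ih T₂ F₁ 0 rs₁ hs₂
      else
        withLit (topBit P) fun w =>
          ifb (withLit (Nat.lor T w) fun T' => ih T' F 0 rs hs) then
            withLit (Nat.xor P w) fun P' =>
              ifb Nat.beq P' 0 then true
              else withLit (Nat.lor F w) fun F' => ih T F' P' rs hs
          else false) n

/-! ### Soundness of the search -/

section Soundness

variable (z : ℕ → Prop)

/-- All bits of `A` are good. -/
def AllGood (A : ℕ) : Prop := ∀ i, A.testBit i = true → z i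

/-- All bits of `A` are bad. -/
def AllBad (A : ℕ) : Prop := ∀ i, A.testBit i = true → ¬ z i

/-- Some bit of `A` is good. -/
def SomeGood (A : ℕ) : Prop := ∃ i, A.testBit i = true ∧ z i

/-- All rules in the list hold. -/
def RuleList.Holds : RuleList → Prop
  | .nil => True
  | .cons A B t => (AllGood z A → AllGood z B) ∧ t.Holds

variable {z}

theorem AllGood.lor {A B : ℕ} (hA : AllGood z A) (hB : AllGood z B) :
    AllGood z (Nat.lor A B) := by
  intro i hi
  have : (A ||| B).testBit i = true := hi
  rw [Nat.testBit_or, Bool.or_eq_true] at this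
  exact this.elim (hA i) (hB i)

theorem AllBad.lor {A B : ℕ} (hA : AllBad z A) (hB : AllBad z B) :
    AllBad z (Nat.lor A B) := by
  intro i hi
  have : (A ||| B).testBit i = true := hi
  rw [Nat.testBit_or, Bool.or_eq_true] at this
  exact this.elim (hA i) (hB i)

theorem testBit_xor_land (A T i : ℕ) :
    (Nat.xor A (Nat.land A T)).testBit i = (A.testBit i && !T.testBit i) := by
  change (A ^^^ (A &&& T)).testBit i = _
  rw [Nat.testBit_xor, Nat.testBit_and]
  cases A.testBit i <;> cases T.testBit i <;> rfl

theorem testBit_topBit (r i : ℕ) : (topBit r).testBit i = true ↔ Nat.log2 r = i := by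
  change (2 ^ Nat.log2 r).testBit i = true ↔ _
  rw [Nat.testBit_two_pow]; simp

theorem exists_of_land_ne_zero {A B : ℕ} (h : Nat.beq (Nat.land A B) 0 = false) :
    ∃ i, A.testBit i = true ∧ B.testBit i = true := by
  have h0 : A &&& B ≠ 0 := fun h0 => by
    have : Nat.beq (Nat.land A B) 0 = true := Nat.beq_eq.mpr h0
    rw [this] at h; cases h
  obtain ⟨i, hi⟩ := Nat.exists_testBit_of_ne_zero h0
  rw [Nat.testBit_and, Bool.and_eq_true] at hi
  exact ⟨i, hi⟩

theorem allGood_of_xor_eq_zero {A T : ℕ} (hT : AllGood z T)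
    (h : Nat.xor A (Nat.land A T) = 0) : AllGood z A := by
  intro i hi
  have := testBit_xor_land A T i
  rw [h, Nat.zero_testBit, hi] at this
  exact hT i (by simpa using this.symm)

/-- Contrapositive unit propagation: the conclusion of the rule meets a bad bit, so some premise bit
is bad, and only one premise bit lies outside `T`. The test `topBit r = r` says that `r` is a single
bit. -/
theorem allBad_of_rule {A B T F : ℕ} (hT : AllGood z T) (hF : AllBad z F)
    (hAB : AllGood z A → AllGood z B) (hBF : Nat.beq (Nat.land B F) 0 = false)
    (hr : Nat.beq (topBit (Nat.xor A (Nat.land A T))) (Nat.xor A (Nat.land A T)) = true) :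
    AllBad z (Nat.xor A (Nat.land A T)) := by
  obtain ⟨i, hB, hFi⟩ := exists_of_land_ne_zero hBF
  have hA : ¬ AllGood z A := fun h => hF i hFi (hAB h i hB)
  obtain ⟨j, hj, hzj⟩ : ∃ j, A.testBit j = true ∧ ¬ z j := by
    simpa [AllGood] using hA
  have hTj : T.testBit j = false := by
    by_contra h
    exact hzj (hT j (by simpa using h))
  have key : ∀ m, (Nat.xor A (Nat.land A T)).testBit m = true →
      Nat.log2 (Nat.xor A (Nat.land A T)) = m := fun m hm =>
    (testBit_topBit _ m).1 (by rwa [Nat.eq_of_beq_eq_true hr])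
  intro m hm
  have hjr : (Nat.xor A (Nat.land A T)).testBit j = true := by
    rw [testBit_xor_land, hj, hTj]; rfl
  rw [← key m hm, key j hjr]
  exact hzj

theorem someGood_xor {P F : ℕ} (hF : AllBad z F) (hP : SomeGood z P) :
    SomeGood z (Nat.xor P (Nat.land P F)) := by
  obtain ⟨i, hi, hz⟩ := hP
  refine ⟨i, ?_, hz⟩
  rw [testBit_xor_land, hi]
  cases h : F.testBit i
  · rfl
  · exact absurd hz (hF i h)

theorem SomeGood.ne_zero {P : ℕ} (hP : SomeGood z P) : P ≠ 0 := by
  rintro rfl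
  obtain ⟨i, hi, -⟩ := hP
  simp at hi

theorem SomeGood.allGood_of_topBit {r : ℕ} (h : SomeGood z r) (hr : topBit r = r) :
    AllGood z r := by
  obtain ⟨i, hi, hz⟩ := h
  have key : ∀ m, r.testBit m = true → Nat.log2 r = m := fun m hm =>
    (testBit_topBit _ m).1 (by rwa [hr])
  intro m hm
  rw [← key m hm, key i hi]
  exact hz

theorem passRules_sound (l : RuleList) : ∀ (T F : ℕ) (acc : RuleList)
    (k : ℕ → ℕ → RuleList → Bool), l.Holds z → acc.Holds z → AllGood z T → AllBad z F →
    passRules l T F acc k = true →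
    ∃ T' F' acc', AllGood z T' ∧ AllBad z F' ∧ RuleList.Holds z acc' ∧ k T' F' acc' = true := by
  induction l with
  | nil => exact fun T F acc k _ hacc hT hF h => ⟨T, F, acc, hT, hF, hacc, h⟩
  | cons A B t ih =>
    intro T F acc k hl hacc hT hF h
    obtain ⟨hAB, ht⟩ := hl
    have hstep : passRules (RuleList.cons A B t) T F acc k =
      ifb Nat.beq (Nat.land A F) 0 then
        ifb Nat.beq (Nat.land B T) B then passRules t T F acc k
        else withLit (Nat.xor A (Nat.land A T)) fun r =>
          ifb Nat.beq r 0 then withLit (Nat.lor T B) fun T' => passRules t T' F acc k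
          else ifb Nat.beq (Nat.land B F) 0 then passRules t T F (RuleList.cons A B acc) k
          else ifb Nat.beq (topBit r) r then
            withLit (Nat.lor F r) fun F' => passRules t T F' acc k
          else passRules t T F (RuleList.cons A B acc) k
      else passRules t T F acc k := rfl
    rw [hstep] at h
    simp only [withLit_eq] at h
    cases h₁ : Nat.beq (Nat.land A F) 0
    · rw [h₁] at h
      exact ih T F acc k ht hacc hT hF h
    rw [h₁] at h
    cases h₂ : Nat.beq (Nat.land B T) B
    swap
    · rw [h₂] at h
      exact ih T F acc k ht hacc hT hF h
    rw [h₂] at h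
    cases h₃ : Nat.beq (Nat.xor A (Nat.land A T)) 0
    swap
    · rw [h₃] at h
      exact ih _ F acc k ht hacc
        (hT.lor (hAB (allGood_of_xor_eq_zero hT (Nat.eq_of_beq_eq_true h₃)))) hF h
    rw [h₃] at h
    cases h₄ : Nat.beq (Nat.land B F) 0
    swap
    · rw [h₄] at h
      exact ih T F (RuleList.cons A B acc) k ht ⟨hAB, hacc⟩ hT hF h
    rw [h₄] at h
    cases h₅ : Nat.beq (topBit (Nat.xor A (Nat.land A T))) (Nat.xor A (Nat.land A T))
    · rw [h₅] at h
      exact ih T F (RuleList.cons A B acc) k ht ⟨hAB, hacc⟩ hT hF h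
    rw [h₅] at h
    exact ih T _ acc k ht hacc hT (hF.lor (allBad_of_rule hT hF hAB h₄ h₅)) h

theorem passHits_sound (l : List ℕ) : ∀ (T F : ℕ) (acc : List ℕ) (k : ℕ → List ℕ → Bool),
    (∀ P ∈ l, SomeGood z P) → (∀ P ∈ acc, SomeGood z P) → AllGood z T → AllBad z F →
    passHits l T F acc k = true →
    ∃ T' acc', AllGood z T' ∧ (∀ P ∈ acc', SomeGood z P) ∧ k T' acc' = true := by
  induction l with
  | nil => exact fun T F acc k _ hacc hT _ h => ⟨T, acc, hT, hacc, h⟩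
  | cons P t ih =>
    intro T F acc k hl hacc hT hF h
    obtain ⟨hP, ht⟩ := List.forall_mem_cons.1 hl
    have hstep : passHits (P :: t) T F acc k =
      ifb Nat.beq (Nat.land P T) 0 then
        withLit (Nat.xor P (Nat.land P F)) fun r =>
          ifb Nat.beq r 0 then true
          else ifb Nat.beq (topBit r) r then withLit (Nat.lor T r) fun T' => passHits t T' F acc k
          else passHits t T F (r :: acc) k
      else passHits t T F acc k := rfl
    rw [hstep] at h
    simp only [withLit_eq] at h
    have hr := someGood_xor hF hP
    cases h₁ : Nat.beq (Nat.land P T) 0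
    · rw [h₁] at h
      exact ih T F acc k ht hacc hT hF h
    rw [h₁] at h
    cases h₂ : Nat.beq (Nat.xor P (Nat.land P F)) 0
    swap
    · exact absurd (Nat.eq_of_beq_eq_true h₂) hr.ne_zero
    rw [h₂] at h
    cases h₃ : Nat.beq (topBit (Nat.xor P (Nat.land P F))) (Nat.xor P (Nat.land P F))
    · rw [h₃] at h
      exact ih T F _ k ht (List.forall_mem_cons.2 ⟨hr, hacc⟩) hT hF h
    rw [h₃] at h
    exact ih _ F acc k ht hacc
      (hT.lor (hr.allGood_of_topBit (Nat.eq_of_beq_eq_true h₃))) hF h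

theorem minHit_sound (l : List ℕ) : ∀ (P c : ℕ) (k : ℕ → Bool),
    minHit l P c k = true → ∃ Q, (Q = P ∨ Q ∈ l) ∧ k Q = true := by
  induction l with
  | nil => exact fun P _ k h => ⟨P, Or.inl rfl, h⟩
  | cons Q t ih =>
    intro P c k h
    have hstep : minHit (Q :: t) P c k = withLit (weightThirtySix Q) fun d =>
      ifb Nat.ble c d then minHit t P c k else minHit t Q d k := rfl
    rw [hstep] at h
    simp only [withLit_eq] at h
    cases h₁ : Nat.ble c (weightThirtySix Q)
    · rw [h₁] at h
      obtain ⟨R, hR, hk⟩ := ih _ _ _ h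
      exact ⟨R, Or.inr (List.mem_cons.2 hR), hk⟩
    · rw [h₁] at h
      obtain ⟨R, hR, hk⟩ := ih _ _ _ h
      exact ⟨R, hR.imp_right (List.mem_cons_of_mem _), hk⟩

theorem clash_sound {T F : ℕ} (hT : AllGood z T) (hF : AllBad z F) (hz : ∃ i < 32, ¬ z i) :
    clash T F = false := by
  by_contra h
  rw [Bool.not_eq_false] at h
  unfold clash at h
  cases h₁ : Nat.beq (Nat.land T F) 0
  · obtain ⟨i, hTi, hFi⟩ := exists_of_land_ne_zero h₁
    exact hF i hFi (hT i hTi)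
  · rw [h₁] at h
    have hT' : T = 2 ^ 32 - 1 := Nat.eq_of_beq_eq_true h
    obtain ⟨i, hi, hzi⟩ := hz
    refine hzi (hT i ?_)
    rw [hT', Nat.testBit_two_pow_sub_one]
    simpa using hi

/-- An actual set `z` survives propagation and always follows one of the two branches at the top bit
of `P`, so that branch cannot return `true`. Exhausted fuel gives `false`, which certifies nothing
and is harmless. -/
theorem search_sound (hz : ∃ i < 32, ¬ z i) (n : ℕ) : ∀ (T F P : ℕ) (rs : RuleList)
    (hs : List ℕ), AllGood z T → AllBad z F → (P ≠ 0 → SomeGood z P) → rs.Holds z →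
    (∀ P ∈ hs, SomeGood z P) → search n T F P rs hs = false := by
  induction n with
  | zero => exact fun _ _ _ _ _ _ _ _ _ _ => rfl
  | succ n ih =>
    intro T F P rs hs hT hF hP hrs hhs
    by_contra h
    rw [Bool.not_eq_false] at h
    have hstep : search (n + 1) T F P rs hs =
      ifb Nat.beq P 0 then
        passRules rs T F RuleList.nil fun T₁ F₁ rs₁ =>
          ifb clash T₁ F₁ then true
          else passHits hs T₁ F₁ [] fun T₂ hs₂ =>
            ifb clash T₂ F₁ then true
            else ifb (ifb Nat.beq T T₂ then Nat.beq F F₁ else false) then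
              List.rec (motive := fun _ => Bool) false (fun Q t _ =>
                minHit t Q (weightThirtySix Q) fun Q' => search n T₂ F₁ Q' rs₁ hs₂) hs₂
            else search n T₂ F₁ 0 rs₁ hs₂
      else
        withLit (topBit P) fun w =>
          ifb (withLit (Nat.lor T w) fun T' => search n T' F 0 rs hs) then
            withLit (Nat.xor P w) fun P' =>
              ifb Nat.beq P' 0 then true
              else withLit (Nat.lor F w) fun F' => search n T F' P' rs hs
          else false := rfl
    rw [hstep] at h
    simp only [withLit_eq] at h
    cases h₁ : Nat.beq P 0
    · rw [h₁] at h
      have hP0 : P ≠ 0 := fun h0 => by rw [h0] at h₁; cases h₁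
      obtain ⟨i, hi, hzi⟩ := hP hP0
      by_cases hw : z (Nat.log2 P)
      · have hT' : AllGood z (Nat.lor T (topBit P)) := hT.lor fun j hj => by
          rwa [← (testBit_topBit P j).1 hj]
        have := ih _ F 0 rs hs hT' hF (fun h => absurd rfl h) hrs hhs
        rw [this] at h
        cases h
      · have hF' : AllBad z (Nat.lor F (topBit P)) := hF.lor fun j hj => by
          rwa [← (testBit_topBit P j).1 hj]
        have hP' : SomeGood z (Nat.xor P (topBit P)) := by
          refine ⟨i, ?_, hzi⟩
          change (P ^^^ topBit P).testBit i = true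
          have : (topBit P).testBit i = false := by
            rw [← Bool.not_eq_true, testBit_topBit]
            rintro rfl
            exact hw hzi
          rw [Nat.testBit_xor, hi, this]; rfl
        have := ih T _ _ rs hs hT hF' (fun _ => hP') hrs hhs
        rw [this] at h
        have h0 : Nat.beq (Nat.xor P (topBit P)) 0 = false := by
          cases h0 : Nat.beq (Nat.xor P (topBit P)) 0
          · rfl
          · exact absurd (Nat.eq_of_beq_eq_true h0) hP'.ne_zero
        rw [h0] at h
        revert h
        cases search n (Nat.lor T (topBit P)) F 0 rs hs <;> exact Bool.noConfusion
    · rw [h₁] at h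
      obtain ⟨T₁, F₁, rs₁, hT₁, hF₁, hrs₁, h⟩ := passRules_sound rs T F RuleList.nil _ hrs trivial hT hF h
      rw [clash_sound hT₁ hF₁ hz] at h
      obtain ⟨T₂, hs₂, hT₂, hhs₂, h⟩ := passHits_sound hs T₁ F₁ [] _ hhs (by simp) hT₁ hF₁ h
      rw [clash_sound hT₂ hF₁ hz] at h
      cases h₂ : (ifb Nat.beq T T₂ then Nat.beq F F₁ else false)
      · rw [h₂] at h
        have := ih T₂ F₁ 0 rs₁ hs₂ hT₂ hF₁ (fun h => absurd rfl h) hrs₁ hhs₂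
        exact Bool.noConfusion (this.symm.trans h)
      · rw [h₂] at h
        cases hs₂ with
        | nil => cases h
        | cons Q t =>
          obtain ⟨Q', hQ', h⟩ := minHit_sound t Q _ _ h
          have := ih T₂ F₁ Q' rs₁ (Q :: t) hT₂ hF₁
            (fun _ => hhs₂ Q' (List.mem_cons.2 hQ')) hrs₁ hhs₂
          exact Bool.noConfusion (this.symm.trans h)

end Soundness

/-! ### The rules and hitting conditions for quadratic forms on sign vectors of length six -/

/-- The representative below `32` of a mask below `64` up to complementation. -/
def halfMask (x : ℕ) : ℕ := cond (Nat.blt x 32) x (63 - x)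

/-- The mask of the representatives of the translates by `v` of the members of `l`. -/
def orbitMask (v : ℕ) (l : List ℕ) : ℕ :=
  l.foldr (fun x m => Nat.lor (Nat.pow 2 (halfMask (Nat.xor v x))) m) 0

/-- The partitions of `{0, …, n - 1}` into masks. -/
def setPartitions : ℕ → List (List ℕ)
  | 0 => [[]]
  | n + 1 => (setPartitions n).flatMap fun p =>
      (2 ^ n :: p) :: (List.range p.length).map fun i => p.modify i (· + 2 ^ n)

/-- The pairwise `xor`s of the members of a list. -/
def pairXors : List ℕ → List ℕ
  | [] => []
  | b :: l => l.map (Nat.xor b) ++ pairXors l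

/-- For every quadratic form, the sum of its values at the sign vectors coded by the first list is
the sum of its values at those coded by the second. -/
def IsRelation (r : List ℕ × List ℕ) : Prop :=
  r.1.length = r.2.length ∧ ∀ i < 6, ∀ j < 6,
    (r.1.countP fun x => x.testBit i ^^ x.testBit j) =
      r.2.countP fun x => x.testBit i ^^ x.testBit j

instance (r : List ℕ × List ℕ) : Decidable (IsRelation r) :=
  inferInstanceAs (Decidable (_ ∧ _))

/-- The relation between the values of a quadratic form at a sign vector and at the sign vectors that
arise from it by flipping one or two blocks of the partition `p`. -/
def starRelation : List ℕ → List ℕ × List ℕ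
  | [a, b, c, d] => ([a, b, c, d], [0, Nat.xor a b, Nat.xor a c, Nat.xor a d])
  -- For `k` blocks `a_i` the relation is `(k - 2) ∑ f(a_i) = k(k - 3)/2 · f(0) + ∑_{i<j} f(a_i +
  -- a_j)`. When `k = 4`, complementary pairs coincide and a factor `2` cancels, which is the case
  -- above.
  | p => ((List.replicate (p.length - 2) p).flatten,
      List.replicate (p.length * (p.length - 3) / 2) 0 ++ pairXors p)

/-- The relations used in the search: those of the partitions of the six coordinates into at least
four blocks, and one that combines two of them. -/
def relations : List (List ℕ × List ℕ) :=
  -- The difference of the relations for the blocks `1, 2, 4, 56` and `8, 16, 32, 7`: the terms at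
  -- `0` cancel, as do those at the antipodal masks `7` and `56`.
  ([1, 2, 4, 24, 40, 48], [8, 16, 32, 3, 5, 6]) ::
    ((setPartitions 6).filter fun p => 4 ≤ p.length).map starRelation

/-- The translates of a relation; duplicates are omitted for partitions into four blocks. -/
def relationRules (r : List ℕ × List ℕ) : List (ℕ × ℕ) :=
  ((List.range 32).filter fun v => Nat.blt 4 r.1.length ||
    Nat.beq (orbitMask v r.2 % 2 ^ v) 0).map fun v => (orbitMask v r.1, orbitMask v r.2)

/-- All implications between the zeros of a nonnegative form that come from the relations. -/
def baseRules : List (ℕ × ℕ) := relations.flatMap relationRules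

/-- The masks with a single bit. -/
def singles : List ℕ := [1, 2, 4, 8, 16, 32]

/-- No sign vector has more than `k` good neighbours. -/
def crowdRules (k : ℕ) : List (ℕ × ℕ) :=
  ((List.range 64).filter fun m => Nat.beq (weightSix m) (k + 1)).flatMap fun m =>
    (List.range 32).map fun v =>
      (orbitMask v (singles.filter fun b => Nat.beq (Nat.land b m) b), 4294967295)

/-- The absolute values of the facet vectors; a pair of masks codes the sum of their indicator
vectors. -/
def hitPatterns : List (ℕ × ℕ) :=
  ((List.range 64).filter fun m => Nat.beq (weightSix m) 3 || Nat.beq (weightSix m) 5).map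
    (fun m => (m, 0)) ++ singles.map fun b => (63, b)

/-- The sum of the entries of the pattern `a` at the bits of `x`. -/
def patternWeight (a : ℕ × ℕ) (x : ℕ) : ℕ :=
  weightSix (Nat.land a.1 x) + weightSix (Nat.land a.2 x)

/-- The sign vectors whose inner product with the pattern is not `±1`. -/
def patternSupport (a : ℕ × ℕ) : List ℕ :=
  (List.range 32).filter fun x =>
    !(Nat.beq (2 * patternWeight a x + 1) (patternWeight a 63) ||
      Nat.beq (2 * patternWeight a x) (patternWeight a 63 + 1))

/-- The supports on sign vectors of the forms `(e ⬝ u) ^ 2 - 1` for signed patterns `e`. -/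
def hitMasks : List ℕ :=
  -- The comparison of `s` with its complement in `a.1` keeps one of `e` and `-e`.
  hitPatterns.flatMap fun a => ((List.range 64).filter fun s => Nat.beq (Nat.land s a.1) s &&
    Nat.blt s (Nat.xor a.1 s)).map fun s => orbitMask s (patternSupport a)

/-- Evaluates the masks in `l` and adds the rules to `acc`. -/
noncomputable def forceRules (l : List (ℕ × ℕ)) : RuleList → (RuleList → Bool) → Bool :=
  List.rec (motive := fun _ => RuleList → (RuleList → Bool) → Bool)
    (fun acc k => k acc)
    (fun R _ ih acc k => withLit R.1 fun A => withLit R.2 fun B => ih (RuleList.cons A B acc) k) l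

/-- Evaluates the masks in `l` and adds them to `acc`. -/
def forceHits (l : List ℕ) : List ℕ → (List ℕ → Bool) → Bool :=
  List.rec (motive := fun _ => List ℕ → (List ℕ → Bool) → Bool)
    (fun acc k => k acc)
    (fun P _ ih acc k => withLit P fun P' => ih (P' :: acc) k) l

/-- The search for zero sets in which the sign vector `1` has exactly its first `k` neighbours and no
sign vector has more than `k` neighbours. -/
noncomputable def crowdSearch (rs : RuleList) (hs : List ℕ) (k : ℕ) : Bool :=
  forceRules (crowdRules k) rs fun rs' =>
    withLit (orbitMask 0 (singles.take k)) fun T =>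
      withLit (orbitMask 0 (singles.drop k)) fun F => search 400 T F 0 rs' hs

-- The computational core, run by the kernel. The case `k = 0` is not needed, since a reduced form
-- has a zero and hence a sign vector with a zero neighbour.
set_option maxRecDepth 100000 in
theorem crowdSearch_eq_true :
    (forceRules baseRules RuleList.nil fun rs => forceHits hitMasks [] fun hs =>
      [1, 2, 3, 4, 5, 6].all (crowdSearch rs hs)) = true := by
  decide +kernel

-- A relation between quadratic forms need only be tested on the monomials `u_i u_j`, where it
-- becomes a count of masks with differing bits `i` and `j`.
set_option maxRecDepth 100000 in
theorem isRelation_of_mem_relations : ∀ r ∈ relations, IsRelation r := by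
  decide +kernel

/-! ### From the search result to a statement about sets of good bits. -/

theorem forceRules_sound {z : ℕ → Prop} (l : List (ℕ × ℕ)) : ∀ (acc : RuleList)
    (k : RuleList → Bool), (∀ R ∈ l, AllGood z R.1 → AllGood z R.2) → acc.Holds z →
    forceRules l acc k = true → ∃ rs : RuleList, rs.Holds z ∧ k rs = true := by
  induction l with
  | nil => exact fun acc k _ hacc h => ⟨acc, hacc, h⟩
  | cons R t ih =>
    intro acc k hl hacc h
    obtain ⟨hR, ht⟩ := List.forall_mem_cons.1 hl
    have hstep : forceRules (R :: t) acc k = withLit R.1 fun A => withLit R.2 fun B =>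
      forceRules t (RuleList.cons A B acc) k := rfl
    rw [hstep, withLit_eq, withLit_eq] at h
    exact ih (RuleList.cons R.1 R.2 acc) k ht ⟨hR, hacc⟩ h

theorem forceHits_sound {z : ℕ → Prop} (l : List ℕ) : ∀ (acc : List ℕ)
    (k : List ℕ → Bool), (∀ P ∈ l, SomeGood z P) → (∀ P ∈ acc, SomeGood z P) →
    forceHits l acc k = true → ∃ hs : List ℕ, (∀ P ∈ hs, SomeGood z P) ∧ k hs = true := by
  induction l with
  | nil => exact fun acc k _ hacc h => ⟨acc, hacc, h⟩
  | cons P t ih =>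
    intro acc k hl hacc h
    obtain ⟨hP, ht⟩ := List.forall_mem_cons.1 hl
    have hstep : forceHits (P :: t) acc k = withLit P fun P' => forceHits t (P' :: acc) k := rfl
    rw [hstep, withLit_eq] at h
    exact ih _ k ht (List.forall_mem_cons.2 ⟨hP, hacc⟩) h

theorem testBit_orbitMask (v : ℕ) (l : List ℕ) (i : ℕ) :
    (orbitMask v l).testBit i = true ↔ ∃ x ∈ l, halfMask (v ^^^ x) = i := by
  induction l with
  | nil => simp [orbitMask]
  | cons x l ih =>
    change ((2 ^ halfMask (v ^^^ x)) ||| orbitMask v l).testBit i = true ↔ _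
    rw [Nat.testBit_or, Bool.or_eq_true, ih, Nat.testBit_two_pow]
    simp

theorem allGood_orbitMask {z : ℕ → Prop} {v : ℕ} {l : List ℕ} :
    AllGood z (orbitMask v l) ↔ ∀ x ∈ l, z (halfMask (v ^^^ x)) := by
  simp only [AllGood, testBit_orbitMask]
  exact ⟨fun h x hx => h _ ⟨x, hx, rfl⟩, fun h i ⟨x, hx, hi⟩ => hi ▸ h x hx⟩

theorem not_crowd {z : ℕ → Prop} (hz : ∃ i < 32, ¬ z i) {k : ℕ} (hk : k ∈ [1, 2, 3, 4, 5, 6])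
    (hbase : ∀ R ∈ baseRules, AllGood z R.1 → AllGood z R.2)
    (hhits : ∀ P ∈ hitMasks, SomeGood z P)
    (hcrowd : ∀ R ∈ crowdRules k, ¬ AllGood z R.1)
    (hT : ∀ x ∈ singles.take k, z (halfMask x)) (hF : ∀ x ∈ singles.drop k, ¬ z (halfMask x)) :
    False := by
  obtain ⟨rs, hrs, h⟩ := forceRules_sound _ RuleList.nil _ hbase trivial crowdSearch_eq_true
  obtain ⟨hs, hhs, h⟩ := forceHits_sound _ [] _ hhits (by simp) h
  have h := List.all_eq_true.1 h k hk
  -- The crowding rules hold vacuously: `hcrowd` denies their premises.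
  obtain ⟨rs', hrs', h⟩ := forceRules_sound _ _ _
    (fun R hR hA => absurd hA (hcrowd R hR)) hrs h
  rw [withLit_eq, withLit_eq, search_sound hz] at h
  · cases h
  · exact allGood_orbitMask.2 fun x hx => by simpa using hT x hx
  · intro i hi
    obtain ⟨x, hx, rfl⟩ := (testBit_orbitMask _ _ _).1 hi
    simpa using hF x hx
  · exact fun h => absurd rfl h
  · exact hrs'
  · exact hhs

/-! ### Quadratic forms on sign vectors -/

/-- The value of the quadratic form with matrix `B`. -/
def quadVal {N : ℕ} (B : Matrix (Fin N) (Fin N) ℝ) (u : Fin N → ℝ) : ℝ :=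
  ∑ i, ∑ j, B i j * u i * u j

/-- The sign vector of length six coded by the bits of `x`. -/
def signVec (x : ℕ) (i : Fin 6) : ℝ := if x.testBit i then -1 else 1

theorem signVec_mem (x : ℕ) : signVec x ∈ signVectors 6 := by
  intro i
  unfold signVec
  split <;> simp

theorem signVec_xor (x y : ℕ) (i : Fin 6) : signVec (x ^^^ y) i = signVec x i * signVec y i := by
  unfold signVec
  rw [Nat.testBit_xor]
  cases x.testBit i <;> cases y.testBit i <;> norm_num

theorem testBit_compl {x : ℕ} (hx : x < 64) (i : Fin 6) :
    (63 - x).testBit i = !x.testBit i := by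
  have h : ∀ x < 64, ∀ i : Fin 6, (63 - x).testBit i = !x.testBit i := by decide +kernel
  exact h x hx i

theorem signVec_halfMask {x : ℕ} (hx : x < 64) :
    signVec (halfMask x) = signVec x ∨ signVec (halfMask x) = -signVec x := by
  unfold halfMask
  cases Nat.blt x 32
  · right
    ext i
    simp only [signVec, cond_false, testBit_compl hx, Pi.neg_apply]
    cases x.testBit i <;> simp
  · exact Or.inl rfl

theorem halfMask_lt {x : ℕ} (hx : x < 64) : halfMask x < 32 := by
  have h : ∀ x < 64, halfMask x < 32 := by decide +kernel
  exact h x hx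

theorem exists_signVec {u : Fin 6 → ℝ} (hu : u ∈ signVectors 6) : ∃ x < 64, u = signVec x := by
  classical
  refine ⟨Nat.ofBits fun i : Fin 6 => decide (u i = -1), Nat.ofBits_lt_two_pow _, ?_⟩
  ext i
  rw [signVec, Nat.testBit_ofBits_lt _ _ i.2]
  rcases hu i with h | h <;> simp [h]

theorem quadVal_neg {N : ℕ} (B : Matrix (Fin N) (Fin N) ℝ) (u : Fin N → ℝ) :
    quadVal B (-u) = quadVal B u := by
  simp [quadVal]

theorem quadVal_halfMask (B : Matrix (Fin 6) (Fin 6) ℝ) {x : ℕ} (hx : x < 64) :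
    quadVal B (signVec (halfMask x)) = quadVal B (signVec x) := by
  rcases signVec_halfMask hx with h | h <;> rw [h]
  exact quadVal_neg B _

theorem sum_signVec_mul_signVec (l : List ℕ) (i j : Fin 6) :
    (l.map fun x => signVec x i * signVec x j).sum =
      l.length - 2 * (l.countP fun x => x.testBit i ^^ x.testBit j : ℕ) := by
  induction l with
  | nil => simp
  | cons x l ih =>
    rw [List.map_cons, List.sum_cons, ih, List.countP_cons, List.length_cons]
    unfold signVec
    cases x.testBit i <;> cases x.testBit j <;> simp <;> ring

theorem sum_quadVal_signVec (B : Matrix (Fin 6) (Fin 6) ℝ) (v : ℕ) (l : List ℕ) :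
    (l.map fun x => quadVal B (signVec (v ^^^ x))).sum =
      ∑ i, ∑ j, B i j * signVec v i * signVec v j *
        (l.map fun x => signVec x i * signVec x j).sum := by
  induction l with
  | nil => simp
  | cons x l ih =>
    simp only [List.map_cons, List.sum_cons, ih, mul_add, Finset.sum_add_distrib]
    congr 1
    refine Finset.sum_congr rfl fun i _ => Finset.sum_congr rfl fun j _ => ?_
    rw [signVec_xor, signVec_xor]
    ring

theorem IsRelation.sum_eq {r : List ℕ × List ℕ} (hr : IsRelation r)
    (B : Matrix (Fin 6) (Fin 6) ℝ) (v : ℕ) :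
    (r.1.map fun x => quadVal B (signVec (v ^^^ x))).sum =
      (r.2.map fun x => quadVal B (signVec (v ^^^ x))).sum := by
  rw [sum_quadVal_signVec, sum_quadVal_signVec]
  refine Finset.sum_congr rfl fun i _ => Finset.sum_congr rfl fun j _ => ?_
  rw [sum_signVec_mul_signVec, sum_signVec_mul_signVec, hr.1, hr.2 i i.2 j j.2]

theorem eq_zero_of_sum_map_eq_zero {α : Type*} {f : α → ℝ} (hf : ∀ x, 0 ≤ f x) {l : List α}
    (h : (l.map f).sum = 0) : ∀ x ∈ l, f x = 0 := by
  induction l with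
  | nil => simp
  | cons a l ih =>
    have hl : 0 ≤ (l.map f).sum := List.sum_nonneg (by simpa using fun x _ => hf x)
    rw [List.map_cons, List.sum_cons] at h
    exact List.forall_mem_cons.2 ⟨by linarith [hf a], ih (by linarith [hf a])⟩

theorem relations_lt : ∀ r ∈ relations, (∀ x ∈ r.1, x < 64) ∧ ∀ x ∈ r.2, x < 64 := by
  decide +kernel

theorem xor_lt_sixtyFour {x y : ℕ} (hx : x < 64) (hy : y < 64) : x ^^^ y < 64 :=
  Nat.xor_lt_two_pow (n := 6) hx hy

/-- If all terms on one side of a relation vanish, the terms on the other side are nonnegative with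
sum zero, so they vanish too. Translating by `v` multiplies coordinates by signs and preserves
relations. -/
theorem baseRules_hold {B : Matrix (Fin 6) (Fin 6) ℝ} (hB : ∀ u ∈ signVectors 6, 0 ≤ quadVal B u) :
    ∀ R ∈ baseRules, AllGood (fun x => quadVal B (signVec x) = 0) R.1 →
      AllGood (fun x => quadVal B (signVec x) = 0) R.2 := by
  intro R hR
  obtain ⟨r, hr, hR⟩ := List.mem_flatMap.1 hR
  obtain ⟨v, hv, rfl⟩ := List.mem_map.1 hR
  have hv : v < 64 := by
    have := List.mem_range.1 (List.mem_filter.1 hv).1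
    omega
  obtain ⟨h1, h2⟩ := relations_lt r hr
  simp only [allGood_orbitMask]
  intro hA x hx
  rw [quadVal_halfMask B (xor_lt_sixtyFour hv (h2 x hx))]
  refine eq_zero_of_sum_map_eq_zero (f := fun x => quadVal B (signVec (v ^^^ x)))
    (fun x => hB _ (signVec_mem _)) ?_ x hx
  rw [← (isRelation_of_mem_relations r hr).sum_eq B v]
  refine List.sum_eq_zero fun y hy => ?_
  obtain ⟨x, hx, rfl⟩ := List.mem_map.1 hy
  rw [← quadVal_halfMask B (xor_lt_sixtyFour hv (h1 x hx))]
  exact hA x hx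

/-! ### Reduced forms and the points their zero sets must contain. -/

/-- The quadratic form is nonnegative and nonzero on sign vectors, and no multiple of a form
`(e ⬝ u) ^ 2 - 1` that does not vanish on sign vectors can be subtracted from it. -/
structure IsReducedForm (B : Matrix (Fin 6) (Fin 6) ℝ) : Prop where
  nonneg : ∀ u ∈ signVectors 6, 0 ≤ quadVal B u
  exists_ne_zero : ∃ u ∈ signVectors 6, quadVal B u ≠ 0
  hit : ∀ e ∈ matheronVectors 6, (∃ u ∈ signVectors 6, (∑ i, u i * (e i : ℝ)) ^ 2 ≠ 1) →
    ∃ u ∈ signVectors 6, quadVal B u = 0 ∧ (∑ i, u i * (e i : ℝ)) ^ 2 ≠ 1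

/-- The integer vector with the absolute values given by the pattern `a` and the signs of `s`. -/
def patternVec (a : ℕ × ℕ) (s : ℕ) (i : Fin 6) : ℤ :=
  ((a.1.testBit i).toNat + (a.2.testBit i).toNat) * if s.testBit i then -1 else 1

theorem weightSix_eq (x : ℕ) : weightSix x = ∑ i : Fin 6, (x.testBit i).toNat := by
  have h : ∀ k : ℕ, (x.testBit k).toNat = x / 2 ^ k % 2 := fun k => Nat.toNat_testBit x k
  simp only [h, weightSix, Fin.sum_univ_six]
  norm_num

theorem sum_signVec_mul_patternVec (a : ℕ × ℕ) (s x : ℕ) :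
    ∑ i, signVec x i * (patternVec a s i : ℝ) =
      patternWeight a 63 - 2 * patternWeight a (s ^^^ x) := by
  have h63 : ∀ i : Fin 6, Nat.testBit 63 i = true := by decide
  simp only [patternWeight, weightSix_eq]
  push_cast
  rw [← Finset.sum_add_distrib, ← Finset.sum_add_distrib, Finset.mul_sum, ← Finset.sum_sub_distrib]
  refine Finset.sum_congr rfl fun i _ => ?_
  have e1 : ∀ y z : ℕ, (Nat.land y z).testBit i = (y.testBit i && z.testBit i) :=
    fun y z => Nat.testBit_and y z i
  simp only [e1, h63, Nat.testBit_xor, signVec, patternVec]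
  cases a.1.testBit i <;> cases a.2.testBit i <;> cases s.testBit i <;> cases x.testBit i <;>
    norm_num

theorem hitPatterns_spec : ∀ a ∈ hitPatterns, 3 ≤ patternWeight a 63 ∧ patternWeight a 0 = 0 ∧
    ∃ y < 64, 2 * patternWeight a y + 1 = patternWeight a 63 := by
  decide +kernel

theorem patternVec_mem {a : ℕ × ℕ} (ha : a ∈ hitPatterns) (s : ℕ) :
    patternVec a s ∈ matheronVectors 6 := by
  obtain ⟨-, -, y, -, hy⟩ := hitPatterns_spec a ha
  refine ⟨signVec (s ^^^ y), signVec_mem _, ?_⟩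
  rw [sum_signVec_mul_patternVec, ← Nat.xor_assoc, Nat.xor_self, Nat.zero_xor, ← hy]
  push_cast
  ring

theorem patternVec_nontrivial {a : ℕ × ℕ} (ha : a ∈ hitPatterns) (s : ℕ) :
    ∃ u ∈ signVectors 6, (∑ i, u i * (patternVec a s i : ℝ)) ^ 2 ≠ 1 := by
  obtain ⟨h3, h0, -⟩ := hitPatterns_spec a ha
  refine ⟨signVec s, signVec_mem _, ?_⟩
  rw [sum_signVec_mul_patternVec, Nat.xor_self, h0]
  have : (3 : ℝ) ≤ patternWeight a 63 := by exact_mod_cast h3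
  intro h
  push_cast at h
  nlinarith

namespace IsReducedForm

variable {B : Matrix (Fin 6) (Fin 6) ℝ}

theorem exists_hit (hB : IsReducedForm B) {a : ℕ × ℕ} (ha : a ∈ hitPatterns) (s : ℕ) :
    ∃ x < 64, quadVal B (signVec x) = 0 ∧
      (∑ i, signVec x i * (patternVec a s i : ℝ)) ^ 2 ≠ 1 := by
  obtain ⟨u, hu, h0, h1⟩ := hB.hit _ (patternVec_mem ha s) (patternVec_nontrivial ha s)
  obtain ⟨x, hx, rfl⟩ := exists_signVec hu
  exact ⟨x, hx, h0, h1⟩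

/-- The signs `s` of `e` can be moved into the argument: the signed pattern at `x` has the same
value as the unsigned one at `s ^^^ x`. Passing to the antipode changes neither the form nor `(e ·
u)²`. -/
theorem hitMasks_hold (hB : IsReducedForm B) :
    ∀ P ∈ hitMasks, SomeGood (fun x => quadVal B (signVec x) = 0) P := by
  intro P hP
  obtain ⟨a, ha, hP⟩ := List.mem_flatMap.1 hP
  obtain ⟨s, hs, rfl⟩ := List.mem_map.1 hP
  have hs : s < 64 := List.mem_range.1 (List.mem_filter.1 hs).1
  obtain ⟨x, hx, h0, h1⟩ := hB.exists_hit ha s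
  have hy := xor_lt_sixtyFour hs hx
  have hy' := halfMask_lt hy
  set y := halfMask (s ^^^ x) with hyd
  have hsign : signVec (s ^^^ y) = signVec x ∨ signVec (s ^^^ y) = -signVec x := by
    have hxx : ∀ i, signVec x i = signVec s i * signVec (s ^^^ x) i := fun i => by
      rw [← signVec_xor, ← Nat.xor_assoc, Nat.xor_self, Nat.zero_xor]
    rcases signVec_halfMask hy with h | h
    · left; ext i; rw [signVec_xor, hyd, h, ← hxx]
    · right; ext i; rw [signVec_xor, hyd, h, Pi.neg_apply, Pi.neg_apply, mul_neg, ← hxx]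
  have h0' : quadVal B (signVec (s ^^^ y)) = 0 := by
    rcases hsign with h | h <;> rw [h]
    · exact h0
    · rw [quadVal_neg, h0]
  have h1' : (∑ i, signVec (s ^^^ y) i * (patternVec a s i : ℝ)) ^ 2 ≠ 1 := by
    rcases hsign with h | h <;> rw [h]
    · exact h1
    · simpa only [Pi.neg_apply, neg_mul, Finset.sum_neg_distrib, neg_sq] using h1
  rw [sum_signVec_mul_patternVec, ← Nat.xor_assoc, Nat.xor_self, Nat.zero_xor] at h1'
  have hmem : y ∈ patternSupport a := by
    refine List.mem_filter.2 ⟨List.mem_range.2 hy', ?_⟩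
    rw [Bool.not_eq_true', Bool.or_eq_false_iff]
    constructor
    · by_contra h
      rw [Bool.not_eq_false] at h
      have := Nat.eq_of_beq_eq_true h
      apply h1'
      rw [← this]; push_cast; ring
    · by_contra h
      rw [Bool.not_eq_false] at h
      have : (2 * patternWeight a y : ℝ) = patternWeight a 63 + 1 := by
        exact_mod_cast Nat.eq_of_beq_eq_true h
      apply h1'
      rw [this]; ring
  refine ⟨_, (testBit_orbitMask _ _ _).2 ⟨y, hmem, rfl⟩, ?_⟩
  change quadVal B (signVec (halfMask (s ^^^ y))) = 0
  rw [quadVal_halfMask B (xor_lt_sixtyFour hs (by omega)), h0']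

end IsReducedForm

/-! ### Zero neighbours and the crowding bound. -/

/-- The neighbours of the sign vector coded by `x` at which the form vanishes. -/
noncomputable def zeroNeighbors (B : Matrix (Fin 6) (Fin 6) ℝ) (x : ℕ) : Finset (Fin 6) :=
  open Classical in {i | quadVal B (signVec (x ^^^ 2 ^ (i : ℕ))) = 0}

theorem mem_zeroNeighbors {B : Matrix (Fin 6) (Fin 6) ℝ} {x : ℕ} {i : Fin 6} :
    i ∈ zeroNeighbors B x ↔ quadVal B (signVec (x ^^^ 2 ^ (i : ℕ))) = 0 := by
  simp [zeroNeighbors]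

theorem two_pow_lt_sixtyFour (i : Fin 6) : 2 ^ (i : ℕ) < 64 :=
  Nat.pow_lt_pow_right (a := 2) (by norm_num) i.2

theorem two_pow_mem_filter_singles : ∀ m < 64, ∀ i : Fin 6, m.testBit i = true →
    2 ^ (i : ℕ) ∈ singles.filter fun b => Nat.beq (Nat.land b m) b := by
  decide +kernel

theorem crowdRules_fail {B : Matrix (Fin 6) (Fin 6) ℝ} {k : ℕ}
    (hk : ∀ x < 64, (zeroNeighbors B x).card ≤ k) :
    ∀ R ∈ crowdRules k, ¬ AllGood (fun x => quadVal B (signVec x) = 0) R.1 := by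
  intro R hR hA
  obtain ⟨m, hm, hR⟩ := List.mem_flatMap.1 hR
  obtain ⟨v, hv, rfl⟩ := List.mem_map.1 hR
  obtain ⟨hm, hmk⟩ := List.mem_filter.1 hm
  have hm := List.mem_range.1 hm
  have hv : v < 64 := by have := List.mem_range.1 hv; omega
  have hmk : weightSix m = k + 1 := Nat.eq_of_beq_eq_true hmk
  have hA := allGood_orbitMask.1 hA
  have hsub : (Finset.univ.filter fun i : Fin 6 => m.testBit i = true) ⊆ zeroNeighbors B v := by
    intro i hi
    have := hA _ (two_pow_mem_filter_singles m hm i (Finset.mem_filter.1 hi).2)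
    rw [quadVal_halfMask B (xor_lt_sixtyFour hv (two_pow_lt_sixtyFour i))] at this
    exact mem_zeroNeighbors.2 this
  have hcard := (Finset.card_le_card hsub).trans (hk v hv)
  rw [Finset.card_filter] at hcard
  have : ∑ i : Fin 6, (m.testBit i).toNat = ∑ i : Fin 6, if m.testBit i = true then 1 else 0 :=
    Finset.sum_congr rfl fun i _ => by cases m.testBit i <;> rfl
  rw [weightSix_eq, this] at hmk
  omega

/-! ### Symmetries -/

theorem signVec_eq_intCast (x : ℕ) (i : Fin 6) :
    signVec x i = ((if x.testBit i then -1 else 1 : ℤ) : ℝ) := by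
  unfold signVec
  split <;> simp

theorem signVec_mul_self (x : ℕ) (i : Fin 6) : signVec x i * signVec x i = 1 := by
  unfold signVec
  split <;> simp

theorem signVec_two_pow (i j : Fin 6) : signVec (2 ^ (i : ℕ)) j = if i = j then -1 else 1 := by
  simp only [signVec, Nat.testBit_two_pow, decide_eq_true_eq, Fin.ext_iff]

/-- The permutation by `π` of a vector, followed by multiplication by the sign vector of `x`. -/
noncomputable def signedPerm (x : ℕ) (π : Equiv.Perm (Fin 6)) (u : Fin 6 → ℝ) (j : Fin 6) : ℝ :=
  signVec x j * u (π.symm j)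

/-- The pullback of a quadratic form by a signed permutation. -/
noncomputable def pullback (B : Matrix (Fin 6) (Fin 6) ℝ) (x : ℕ) (π : Equiv.Perm (Fin 6)) :
    Matrix (Fin 6) (Fin 6) ℝ :=
  fun i j => B (π i) (π j) * signVec x (π i) * signVec x (π j)

theorem quadVal_pullback (B : Matrix (Fin 6) (Fin 6) ℝ) (x : ℕ) (π : Equiv.Perm (Fin 6))
    (u : Fin 6 → ℝ) : quadVal (pullback B x π) u = quadVal B (signedPerm x π u) := by
  unfold quadVal pullback signedPerm
  symm
  rw [← Equiv.sum_comp π]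
  refine Finset.sum_congr rfl fun i _ => ?_
  rw [← Equiv.sum_comp π]
  refine Finset.sum_congr rfl fun j _ => ?_
  rw [Equiv.symm_apply_apply, Equiv.symm_apply_apply]
  ring

theorem signedPerm_mem {u : Fin 6 → ℝ} (hu : u ∈ signVectors 6) (x : ℕ)
    (π : Equiv.Perm (Fin 6)) : signedPerm x π u ∈ signVectors 6 := by
  intro j
  unfold signedPerm
  rcases signVec_mem x j with h | h <;> rcases hu (π.symm j) with h' | h' <;> simp [h, h']

theorem exists_signedPerm_eq {w : Fin 6 → ℝ} (hw : w ∈ signVectors 6) (x : ℕ)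
    (π : Equiv.Perm (Fin 6)) : ∃ u ∈ signVectors 6, signedPerm x π u = w := by
  refine ⟨fun i => signVec x (π i) * w (π i), fun i => ?_, ?_⟩
  · rcases signVec_mem x (π i) with h | h <;> rcases hw (π i) with h' | h' <;> simp [h, h']
  · ext j
    simp only [signedPerm, Equiv.apply_symm_apply]
    rw [← mul_assoc, signVec_mul_self, one_mul]

theorem sum_signedPerm_mul (x : ℕ) (π : Equiv.Perm (Fin 6)) (u : Fin 6 → ℝ) (e : Fin 6 → ℤ) :
    ∑ j, signedPerm x π u j * (((if x.testBit j then -1 else 1) * e (π.symm j) : ℤ) : ℝ) =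
      ∑ i, u i * (e i : ℝ) := by
  rw [← Equiv.sum_comp π]
  refine Finset.sum_congr rfl fun i _ => ?_
  rw [Int.cast_mul, ← signVec_eq_intCast]
  simp only [signedPerm, Equiv.symm_apply_apply]
  linear_combination u i * e i * signVec_mul_self x (π i)

theorem IsReducedForm.pullback {B : Matrix (Fin 6) (Fin 6) ℝ} (hB : IsReducedForm B) (x : ℕ)
    (π : Equiv.Perm (Fin 6)) : IsReducedForm (pullback B x π) where
  nonneg u hu := by
    rw [quadVal_pullback]
    exact hB.nonneg _ (signedPerm_mem hu x π)
  exists_ne_zero := by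
    obtain ⟨w, hw, h⟩ := hB.exists_ne_zero
    obtain ⟨u, hu, rfl⟩ := exists_signedPerm_eq hw x π
    exact ⟨u, hu, by rwa [quadVal_pullback]⟩
  hit e := by
    rintro ⟨u₀, hu₀, he⟩ ⟨u₁, hu₁, h₁⟩
    obtain ⟨w, hw, h, h'⟩ := hB.hit
      (fun j => (if x.testBit j then -1 else 1) * e (π.symm j))
      ⟨signedPerm x π u₀, signedPerm_mem hu₀ x π, by rw [sum_signedPerm_mul, he]⟩
      ⟨signedPerm x π u₁, signedPerm_mem hu₁ x π, by rwa [sum_signedPerm_mul]⟩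
    obtain ⟨u, hu, rfl⟩ := exists_signedPerm_eq hw x π
    refine ⟨u, hu, by rwa [quadVal_pullback], ?_⟩
    rwa [sum_signedPerm_mul] at h'

theorem signedPerm_signVec_xor_two_pow {x y v : ℕ} {π : Equiv.Perm (Fin 6)}
    (hy : signedPerm x π (signVec v) = signVec y) (i : Fin 6) :
    signedPerm x π (signVec (v ^^^ 2 ^ (i : ℕ))) = signVec (y ^^^ 2 ^ (π i : ℕ)) := by
  ext j
  rw [signVec_xor, ← hy]
  simp only [signedPerm, signVec_xor, signVec_two_pow, Equiv.eq_symm_apply]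
  ring

theorem card_zeroNeighbors_pullback (B : Matrix (Fin 6) (Fin 6) ℝ) {x y v : ℕ}
    {π : Equiv.Perm (Fin 6)} (hy : signedPerm x π (signVec v) = signVec y) (i : Fin 6) :
    i ∈ zeroNeighbors (pullback B x π) v ↔ π i ∈ zeroNeighbors B y := by
  rw [mem_zeroNeighbors, mem_zeroNeighbors, quadVal_pullback, signedPerm_signVec_xor_two_pow hy]

theorem exists_perm_mem_iff_lt (S : Finset (Fin 6)) :
    ∃ π : Equiv.Perm (Fin 6), ∀ i, π i ∈ S ↔ (i : ℕ) < S.card := by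
  have hS : S.card ≤ 6 := by simpa using S.card_le_univ
  have hcard : Fintype.card {i : Fin 6 // (i : ℕ) < S.card} = Fintype.card {i // i ∈ S} := by
    rw [Fintype.card_coe, Fintype.card_subtype]
    rw [Fin.card_filter_val_lt, min_eq_right hS]
  let ε := Fintype.equivOfCardEq hcard
  refine ⟨ε.extendSubtype, fun i => ?_⟩
  by_cases hi : (i : ℕ) < S.card
  · exact iff_of_true (ε.extendSubtype_mem i hi) hi
  · exact iff_of_false (ε.extendSubtype_not_mem i hi) hi

theorem singles_take : ∀ k ∈ [1, 2, 3, 4, 5, 6], (∀ x ∈ singles.take k, ∃ i : Fin 6,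
    (i : ℕ) < k ∧ x = 2 ^ (i : ℕ)) ∧ ∀ x ∈ singles.drop k, ∃ i : Fin 6,
    ¬ (i : ℕ) < k ∧ x = 2 ^ (i : ℕ) := by
  decide +kernel

/-- Symmetry breaking: a sign vector with the largest number `k` of zero neighbours is carried by a
signed permutation to the all-ones vector, with its zero neighbours in the first `k` directions.
Maximality supplies the crowding rules, and the search excludes every `k`. -/
theorem not_isReducedForm (B : Matrix (Fin 6) (Fin 6) ℝ) : ¬ IsReducedForm B := by
  intro hB
  obtain ⟨x₀, hx₀, hmax⟩ := (Finset.range 64).exists_max_image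
    (fun x => (zeroNeighbors B x).card) ⟨0, by simp⟩
  simp only [Finset.mem_range] at hx₀ hmax
  obtain ⟨π, hπ⟩ := exists_perm_mem_iff_lt (zeroNeighbors B x₀)
  set k := (zeroNeighbors B x₀).card with hk
  have hk6 : k ≤ 6 := by simpa using (zeroNeighbors B x₀).card_le_univ
  have hk1 : 1 ≤ k := by
    -- Any pattern would do; it only serves to produce a zero `x`, which is a zero neighbour of `x
    -- ^^^ 1`.
    have h7 : ((7, 0) : ℕ × ℕ) ∈ hitPatterns := by decide +kernel
    obtain ⟨x, hx, h0, -⟩ := hB.exists_hit h7 0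
    have h1 : 0 ∈ zeroNeighbors B (x ^^^ 1) := by
      rw [mem_zeroNeighbors]
      simpa [Nat.xor_assoc] using h0
    exact (Finset.card_pos.2 ⟨0, h1⟩).trans_le (hmax _ (xor_lt_sixtyFour hx (by norm_num)))
  have hkmem : k ∈ [1, 2, 3, 4, 5, 6] := by
    simp only [List.mem_cons, List.not_mem_nil, or_false]
    omega
  have hB' := hB.pullback x₀ π
  obtain ⟨hT, hF⟩ := singles_take k hkmem
  have h0 : signedPerm x₀ π (signVec 0) = signVec x₀ := by
    ext j
    simp [signedPerm, signVec]
  have hnbr : ∀ i : Fin 6, quadVal (_root_.pullback B x₀ π) (signVec (halfMask (2 ^ (i : ℕ)))) = 0 ↔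
      (i : ℕ) < k := fun i => by
    rw [quadVal_halfMask _ (two_pow_lt_sixtyFour i), ← hπ i,
      ← card_zeroNeighbors_pullback B h0, mem_zeroNeighbors, Nat.zero_xor]
  refine not_crowd (z := fun x => quadVal (_root_.pullback B x₀ π) (signVec x) = 0) ?_ hkmem
    (baseRules_hold hB'.nonneg) hB'.hitMasks_hold (crowdRules_fail fun v _ => ?_) ?_ ?_
  · obtain ⟨u, hu, h⟩ := hB'.exists_ne_zero
    obtain ⟨x, hx, rfl⟩ := exists_signVec hu
    exact ⟨halfMask x, halfMask_lt hx, by rwa [quadVal_halfMask _ hx]⟩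
  · obtain ⟨y, hy, hyv⟩ := exists_signVec (signedPerm_mem (signVec_mem v) x₀ π)
    rw [← Finset.card_map π.toEmbedding]
    refine (Finset.card_le_card fun j hj => ?_).trans (hmax y hy)
    obtain ⟨i, hi, rfl⟩ := Finset.mem_map.1 hj
    exact (card_zeroNeighbors_pullback B hyv i).1 hi
  · intro x hx
    obtain ⟨i, hi, rfl⟩ := hT x hx
    exact (hnbr i).2 hi
  · intro x hx
    obtain ⟨i, hi, rfl⟩ := hF x hx
    exact fun h => hi ((hnbr i).1 h)

/-! ### The zeros of a nonnegative quadratic form on sign vectors -/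

/-- The zeros on sign vectors of every nonnegative quadratic form, neither zero nor positive there,
are zeros of a nonzero form `(e ⬝ u) ^ 2 - 1` with `e` in `E_N`. -/
def HasZeroCover (N : ℕ) : Prop :=
  ∀ B : Matrix (Fin N) (Fin N) ℝ, (∀ u ∈ signVectors N, 0 ≤ quadVal B u) →
    (∃ u ∈ signVectors N, quadVal B u = 0) → (∃ u ∈ signVectors N, quadVal B u ≠ 0) →
    ∃ e ∈ matheronVectors N,
      (∀ u ∈ signVectors N, quadVal B u = 0 → (∑ i, u i * (e i : ℝ)) ^ 2 = 1) ∧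
      ∃ u ∈ signVectors N, (∑ i, u i * (e i : ℝ)) ^ 2 ≠ 1

theorem hasZeroCover_six : HasZeroCover 6 := by
  intro B hB _ hne
  by_contra h
  push Not at h
  refine not_isReducedForm B ⟨hB, hne, fun e he ⟨u, hu, hu'⟩ => ?_⟩
  by_contra hc
  push Not at hc
  exact hu' (h e he hc u hu)

/-! ### Descent to fewer variables. -/

theorem cons_mem_signVectors {N : ℕ} {u : Fin N → ℝ} (hu : u ∈ signVectors N) {t : ℝ}
    (ht : t = -1 ∨ t = 1) : (Fin.cons t u : Fin (N + 1) → ℝ) ∈ signVectors (N + 1) := by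
  intro i
  refine Fin.cases ?_ (fun j => ?_) i
  · simpa using ht
  · simpa using hu j

theorem tail_mem_signVectors {N : ℕ} {u : Fin (N + 1) → ℝ} (hu : u ∈ signVectors (N + 1)) :
    Fin.tail u ∈ signVectors N := fun i => hu i.succ

theorem neg_mem_signVectors {N : ℕ} {u : Fin N → ℝ} (hu : u ∈ signVectors N) :
    -u ∈ signVectors N := by
  intro i
  rcases hu i with h | h <;> simp [h]

/-- The quadratic form in one more variable that ignores the first variable. -/
def padMatrix {N : ℕ} (B : Matrix (Fin N) (Fin N) ℝ) : Matrix (Fin (N + 1)) (Fin (N + 1)) ℝ :=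
  fun i j => Fin.cases (motive := fun _ => ℝ) 0
    (fun i' => Fin.cases (motive := fun _ => ℝ) 0 (fun j' => B i' j') j) i

theorem quadVal_padMatrix {N : ℕ} (B : Matrix (Fin N) (Fin N) ℝ) (u : Fin (N + 1) → ℝ) :
    quadVal (padMatrix B) u = quadVal B (Fin.tail u) := by
  simp [quadVal, padMatrix, Fin.sum_univ_succ, Fin.tail]

theorem sq_eq_one_of_mem_signVectors {N : ℕ} {u : Fin N → ℝ} (hu : u ∈ signVectors N)
    (i : Fin N) : u i ^ 2 = 1 := by
  rcases hu i with h | h <;> rw [h] <;> norm_num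

/-- The padded form ignores the sign `t` of the new variable, so `t e₀ + s = ±1` for both signs at
each zero, with `s` the old linear form. Either `e₀ = 0` and it can be dropped, or `s = 0` at every
zero. -/
theorem HasZeroCover.of_succ {N : ℕ} (hN : 1 ≤ N) (h : HasZeroCover (N + 1)) :
    HasZeroCover N := by
  intro B hB ⟨u₀, hu₀, hz⟩ ⟨u₁, hu₁, hne⟩
  obtain ⟨e, ⟨v, hv, hev⟩, hcover, ⟨w, hw, hew⟩⟩ := h (padMatrix B)
    (fun u hu => by rw [quadVal_padMatrix]; exact hB _ (tail_mem_signVectors hu))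
    ⟨Fin.cons 1 u₀, cons_mem_signVectors hu₀ (Or.inr rfl), by
      rw [quadVal_padMatrix, Fin.tail_cons, hz]⟩
    ⟨Fin.cons 1 u₁, cons_mem_signVectors hu₁ (Or.inr rfl), by
      rwa [quadVal_padMatrix, Fin.tail_cons]⟩
  have hcover' : ∀ u ∈ signVectors N, quadVal B u = 0 → ∀ t : ℝ, (t = -1 ∨ t = 1) →
      (t * e 0 + ∑ i, u i * (e i.succ : ℝ)) ^ 2 = 1 := fun u hu h0 t ht => by
    have := hcover (Fin.cons t u) (cons_mem_signVectors hu ht)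
      (by rw [quadVal_padMatrix, Fin.tail_cons, h0])
    simpa [Fin.sum_univ_succ] using this
  rw [Fin.sum_univ_succ] at hev hew
  by_cases hm : e 0 = 0
  · refine ⟨fun i => e i.succ, ⟨Fin.tail v, tail_mem_signVectors hv, ?_⟩, fun u hu h0 => ?_,
      Fin.tail w, tail_mem_signVectors hw, ?_⟩
    · simpa [hm, Fin.tail] using hev
    · simpa [hm] using hcover' u hu h0 1 (Or.inr rfl)
    · simpa [hm, Fin.tail] using hew
  have hm' : (e 0 : ℝ) ≠ 0 := by exact_mod_cast hm
  have hzero : ∀ u ∈ signVectors N, quadVal B u = 0 →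
      ∑ i, u i * (e i.succ : ℝ) = 0 ∧ (e 0 : ℝ) ^ 2 = 1 := fun u hu h0 => by
    have h1 := hcover' u hu h0 1 (Or.inr rfl)
    have h2 := hcover' u hu h0 (-1) (Or.inl rfl)
    have h3 : (e 0 : ℝ) * ∑ i, u i * (e i.succ : ℝ) = 0 := by linear_combination (h1 - h2) / 4
    have h4 := (mul_eq_zero.1 h3).resolve_left hm'
    rw [h4] at h1
    exact ⟨h4, by linear_combination h1⟩
  -- The new form is `4 s + u_{i₀}`. It is `±1` wherever `s = 0`, in particular at the zero `u₀`,
  -- which gives membership in `E_N`; where `s` is a nonzero integer its absolute value is at least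
  -- `3`.
  let i₀ : Fin N := ⟨0, hN⟩
  have hsum : ∀ u : Fin N → ℝ,
      ∑ i, u i * ((4 * e i.succ + if i = i₀ then 1 else 0 : ℤ) : ℝ) =
        4 * ∑ i, u i * (e i.succ : ℝ) + u i₀ := fun u => by
    simp [mul_add, Finset.sum_add_distrib, Finset.mul_sum, mul_left_comm]
  obtain ⟨hu₀', hm1⟩ := hzero u₀ hu₀ hz
  refine ⟨fun i => 4 * e i.succ + if i = i₀ then 1 else 0, ?_, fun u hu h0 => ?_, ?_⟩
  · rcases hu₀ i₀ with h | h
    · refine ⟨-u₀, neg_mem_signVectors hu₀, ?_⟩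
      rw [hsum]
      simp [hu₀', h]
    · exact ⟨u₀, hu₀, by rw [hsum, hu₀', h]; norm_num⟩
  · rw [hsum, (hzero u hu h0).1, mul_zero, zero_add, sq_eq_one_of_mem_signVectors hu]
  · obtain ⟨a, ha⟩ : ∃ a : ℤ, ∑ i, Fin.tail w i * (e i.succ : ℝ) = a := by
      refine ⟨∑ i, (if Fin.tail w i = 1 then 1 else -1) * e i.succ, ?_⟩
      push_cast
      refine Finset.sum_congr rfl fun i _ => ?_
      rcases tail_mem_signVectors hw i with h | h <;> rw [h] <;> norm_num
    have ha0 : a ≠ 0 := by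
      rintro rfl
      apply hew
      change (w 0 * (e 0 : ℝ) + ∑ i, Fin.tail w i * (e i.succ : ℝ)) ^ 2 = 1
      rw [ha, Int.cast_zero, add_zero, mul_pow, hm1, sq_eq_one_of_mem_signVectors hw, one_mul]
    refine ⟨Fin.tail w, tail_mem_signVectors hw, ?_⟩
    rw [hsum, ha]
    intro h
    have ha1 : (1 : ℝ) ≤ |(a : ℝ)| := by exact_mod_cast Int.one_le_abs ha0
    rcases abs_cases (a : ℝ) with ⟨h1, -⟩ | ⟨h1, -⟩ <;>
      rcases tail_mem_signVectors hw i₀ with h2 | h2 <;> rw [h2] at h <;> nlinarith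

theorem hasZeroCover {N : ℕ} (hN : 1 ≤ N) (hN6 : N ≤ 6) : HasZeroCover N :=
  Nat.decreasingInduction' (P := HasZeroCover) (fun _ _ hk => .of_succ (hN.trans hk)) hN6
    hasZeroCover_six

/-! ### Finiteness of the sign vectors and parity of `e · u`. -/

theorem signVectors_finite (N : ℕ) : (signVectors N).Finite := by
  have : signVectors N = Set.univ.pi fun _ => {-1, 1} := by
    ext u
    simp [signVectors, Set.mem_pi]
  rw [this]
  exact Set.Finite.pi fun _ => Set.toFinite _

theorem one_mem_signVectors (N : ℕ) : (1 : Fin N → ℝ) ∈ signVectors N := fun _ => Or.inr rfl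

/-- An integer combination of signs with odd coefficient sum is an odd integer. -/
theorem one_le_sq_sum_of_odd {N : ℕ} {u : Fin N → ℝ} (hu : u ∈ signVectors N) {e : Fin N → ℤ}
    (he : Odd (∑ i, e i)) : 1 ≤ (∑ i, u i * (e i : ℝ)) ^ 2 := by
  have h : ∃ a : ℤ, Odd a ∧ ∑ i, u i * (e i : ℝ) = a := by
    refine ⟨∑ i, (if u i = 1 then e i else -e i), ?_, ?_⟩
    · have : ∑ i, (if u i = 1 then e i else -e i) =
          ∑ i, e i - 2 * ∑ i, (if u i = 1 then 0 else e i) := by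
        rw [Finset.mul_sum, ← Finset.sum_sub_distrib]
        refine Finset.sum_congr rfl fun i _ => ?_
        split <;> ring
      rw [this]
      exact he.sub_even (even_two_mul _)
    · push_cast
      refine Finset.sum_congr rfl fun i _ => ?_
      rcases hu i with h | h <;> rw [h] <;> norm_num
  obtain ⟨a, ha, h⟩ := h
  rw [h]
  have ha0 : a ≠ 0 := by rintro rfl; simp at ha
  exact_mod_cast (one_le_sq_iff_one_le_abs a).2 (Int.one_le_abs ha0)

theorem odd_sum_of_mem_matheronVectors {N : ℕ} {e : Fin N → ℤ} (he : e ∈ matheronVectors N) :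
    Odd (∑ i, e i) := by
  obtain ⟨u, hu, h⟩ := he
  have : (∑ i, e i : ℤ) = 1 + 2 * ∑ i, (if u i = 1 then 0 else e i) := by
    have : ∑ i, (e i : ℝ) = ∑ i, u i * (e i : ℝ) + 2 * ∑ i, (if u i = 1 then 0 else (e i : ℝ)) := by
      rw [Finset.mul_sum, ← Finset.sum_add_distrib]
      refine Finset.sum_congr rfl fun i _ => ?_
      rcases hu i with h | h <;> rw [h] <;> norm_num
      ring
    rw [h] at this
    exact_mod_cast this
  rw [this]
  exact odd_one.add_even (even_two_mul _)

/-! ### Pairing of quadratic forms with covariances -/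

/-- The entrywise pairing of two matrices. -/
def pairing {N : ℕ} (B ρ : Matrix (Fin N) (Fin N) ℝ) : ℝ := ∑ i, ∑ j, B i j * ρ i j

section Pairing

variable {N : ℕ}

theorem pairing_vecMulVec (B : Matrix (Fin N) (Fin N) ℝ) (u : Fin N → ℝ) :
    pairing B (Matrix.vecMulVec u u) = quadVal B u := by
  simp [pairing, quadVal, Matrix.vecMulVec_apply, mul_assoc]

theorem pairing_sub_smul (B G ρ : Matrix (Fin N) (Fin N) ℝ) (t : ℝ) :
    pairing (B - t • G) ρ = pairing B ρ - t * pairing G ρ := by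
  simp only [pairing, Matrix.sub_apply, Matrix.smul_apply, smul_eq_mul, Finset.mul_sum,
    ← Finset.sum_sub_distrib]
  exact Finset.sum_congr rfl fun i _ => Finset.sum_congr rfl fun j _ => by ring

theorem quadVal_sub_smul (B G : Matrix (Fin N) (Fin N) ℝ) (t : ℝ) (u : Fin N → ℝ) :
    quadVal (B - t • G) u = quadVal B u - t * quadVal G u := by
  simp only [← pairing_vecMulVec, pairing_sub_smul]

theorem pairing_single (i₀ : Fin N) (ρ : Matrix (Fin N) (Fin N) ℝ) :
    pairing (Matrix.single i₀ i₀ 1) ρ = ρ i₀ i₀ := by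
  simp only [pairing, Matrix.single_apply, ite_and]
  simp

theorem quadVal_single (i₀ : Fin N) {u : Fin N → ℝ} (hu : u ∈ signVectors N) :
    quadVal (Matrix.single i₀ i₀ 1) u = 1 := by
  rw [← pairing_vecMulVec, pairing_single, Matrix.vecMulVec_apply, ← sq,
    sq_eq_one_of_mem_signVectors hu]

theorem pairing_vecMulVec_left (a : Fin N → ℝ) (ρ : Matrix (Fin N) (Fin N) ℝ) :
    pairing (Matrix.vecMulVec a a) ρ = ∑ i, ∑ j, ρ i j * a i * a j := by
  simp only [pairing, Matrix.vecMulVec_apply]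
  exact Finset.sum_congr rfl fun i _ => Finset.sum_congr rfl fun j _ => by ring

theorem quadVal_vecMulVec (a u : Fin N → ℝ) :
    quadVal (Matrix.vecMulVec a a) u = (∑ i, u i * a i) ^ 2 := by
  simp only [quadVal, Matrix.vecMulVec_apply, sq, Finset.sum_mul_sum]
  exact Finset.sum_congr rfl fun i _ => Finset.sum_congr rfl fun j _ => by ring

theorem quadVal_eq_toBilin' (B : Matrix (Fin N) (Fin N) ℝ) (u : Fin N → ℝ) :
    quadVal B u = Matrix.toBilin' B u u := by
  rw [Matrix.toBilin'_apply, quadVal]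
  exact Finset.sum_congr rfl fun i _ => Finset.sum_congr rfl fun j _ => by ring

/-- The mixed second difference over flips of coordinates `i` and `j`, starting from the all-ones
vector, is `4 (B i j + B j i)`. -/
theorem add_transpose_eq_zero {B : Matrix (Fin N) (Fin N) ℝ}
    (hB : ∀ u ∈ signVectors N, quadVal B u = 0) {i j : Fin N} (hij : i ≠ j) :
    B i j + B j i = 0 := by
  have h00 := hB 1 (one_mem_signVectors N)
  have h10 := hB (1 - (2 : ℝ) • Pi.single i 1) fun k => by
    by_cases hk : k = i
    · subst hk; left; simp; norm_num
    · right; simp [hk]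
  have h01 := hB (1 - (2 : ℝ) • Pi.single j 1) fun k => by
    by_cases hk : k = j
    · subst hk; left; simp; norm_num
    · right; simp [hk]
  have h11 := hB (1 - (2 : ℝ) • Pi.single i 1 - (2 : ℝ) • Pi.single j 1) fun k => by
    by_cases hk : k = i
    · subst hk; left; simp [hij]; norm_num
    · by_cases hk' : k = j
      · subst hk'; left; simp [hij.symm]; norm_num
      · right; simp [hk, hk']
  rw [quadVal_eq_toBilin'] at h00 h10 h01 h11
  simp only [map_sub, map_smul, LinearMap.sub_apply, LinearMap.smul_apply, smul_eq_mul,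
    Matrix.toBilin'_single] at h00 h10 h01 h11
  linarith

/-- The off-diagonal part of `B` is antisymmetric, so a symmetric `ρ` is seen only through its
diagonal. This agrees with that of the all-ones matrix, whose pairing with `B` is the value at `1`.
-/
theorem pairing_eq_zero {B ρ : Matrix (Fin N) (Fin N) ℝ}
    (hB : ∀ u ∈ signVectors N, quadVal B u = 0) (hρ : ρ.IsSymm) (hρ1 : ∀ i, ρ i i = 1) :
    pairing B ρ = 0 := by
  have hsymm : ∀ σ : Matrix (Fin N) (Fin N) ℝ, σ.IsSymm → 2 * pairing B σ =
      ∑ i, ∑ j, (B i j + B j i) * σ i j := fun σ hσ => by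
    have : ∑ i, ∑ j, B j i * σ i j = pairing B σ := by
      rw [Finset.sum_comm]
      exact Finset.sum_congr rfl fun i _ => Finset.sum_congr rfl fun j _ => by rw [hσ.apply]
    simp only [add_mul, Finset.sum_add_distrib, this]
    rw [pairing]; ring
  have h1 := hB 1 (one_mem_signVectors N)
  rw [← pairing_vecMulVec] at h1
  have h2 := hsymm ρ hρ
  have h3 := hsymm (Matrix.vecMulVec 1 1) (Matrix.transpose_vecMulVec _ _)
  rw [h1, mul_zero] at h3
  have : 2 * pairing B ρ = 0 := by
    rw [h2, h3]
    refine Finset.sum_congr rfl fun i _ => Finset.sum_congr rfl fun j _ => ?_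
    by_cases hij : i = j
    · subst hij; simp [hρ1, Matrix.vecMulVec_apply]
    · rw [add_transpose_eq_zero hB hij, zero_mul, zero_mul]
  linarith

/-- Take `t` to be the minimum of the ratio of `B` to `G` where `G` does not vanish. Zeros of `B`
persist, and the minimiser becomes a new one. -/
theorem exists_sub_smul {B G : Matrix (Fin N) (Fin N) ℝ}
    (hB : ∀ u ∈ signVectors N, 0 ≤ quadVal B u) (hG : ∀ u ∈ signVectors N, 0 ≤ quadVal G u)
    (hGB : ∀ u ∈ signVectors N, quadVal B u = 0 → quadVal G u = 0)
    (hne : ∃ u ∈ signVectors N, quadVal G u ≠ 0) :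
    ∃ t : ℝ, 0 ≤ t ∧ (∀ u ∈ signVectors N, 0 ≤ quadVal (B - t • G) u) ∧
      {u ∈ signVectors N | quadVal (B - t • G) u ≠ 0}.ncard <
        {u ∈ signVectors N | quadVal B u ≠ 0}.ncard := by
  obtain ⟨u₀, hu₀, hu₀'⟩ := hne
  obtain ⟨v, ⟨hv, hv'⟩, hmin⟩ := Set.exists_min_image {u ∈ signVectors N | quadVal G u ≠ 0}
    (fun u => quadVal B u / quadVal G u)
    ((signVectors_finite N).subset fun u hu => hu.1) ⟨u₀, hu₀, hu₀'⟩
  have hGv : 0 < quadVal G v := (hG v hv).lt_of_ne hv'.symm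
  refine ⟨quadVal B v / quadVal G v, div_nonneg (hB v hv) (hG v hv), fun u hu => ?_, ?_⟩
  · rw [quadVal_sub_smul, sub_nonneg]
    by_cases hu' : quadVal G u = 0
    · rw [hu', mul_zero]
      exact hB u hu
    · have := hmin u ⟨hu, hu'⟩
      rwa [le_div_iff₀ ((hG u hu).lt_of_ne (Ne.symm hu'))] at this
  · refine Set.ncard_lt_ncard ⟨fun u ⟨hu, hu'⟩ => ⟨hu, fun h0 => hu' ?_⟩, fun hss => ?_⟩
      ((signVectors_finite N).subset fun u hu => hu.1)
    · rw [quadVal_sub_smul, h0, hGB u hu h0, mul_zero, sub_zero]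
    · refine (hss ⟨hv, fun h0 => hv' (hGB v hv h0)⟩ : v ∈ {u ∈ signVectors N | _}).2 ?_
      rw [quadVal_sub_smul, div_mul_cancel₀ _ hv', sub_self]

/-- The difference of the square of the linear form `e` and a square equal to `1` on sign vectors. -/
theorem quadVal_matheron (i₀ : Fin N) (e : Fin N → ℤ) {u : Fin N → ℝ} (hu : u ∈ signVectors N) :
    quadVal (Matrix.vecMulVec (fun i => (e i : ℝ)) (fun i => (e i : ℝ)) -
      (1 : ℝ) • Matrix.single i₀ i₀ 1) u = (∑ i, u i * (e i : ℝ)) ^ 2 - 1 := by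
  rw [quadVal_sub_smul, quadVal_vecMulVec, quadVal_single i₀ hu, mul_one]

/-- Induction on the number of sign vectors where `B` is nonzero. Each step subtracts a multiple of
a form `G` with nonnegative pairing: `(e · u)² - 1` from the zero cover, or the constant `1` if `B`
has no zero. -/
theorem pairing_nonneg (hN : 1 ≤ N) (hcover : HasZeroCover N) {ρ : Matrix (Fin N) (Fin N) ℝ}
    (hρ : ρ.IsSymm) (hρ1 : ∀ i, ρ i i = 1) (hρe : ∀ e ∈ matheronVectors N, MatheronIneq ρ e)
    {B : Matrix (Fin N) (Fin N) ℝ} (hB : ∀ u ∈ signVectors N, 0 ≤ quadVal B u) :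
    0 ≤ pairing B ρ := by
  let i₀ : Fin N := ⟨0, hN⟩
  induction hn : {u ∈ signVectors N | quadVal B u ≠ 0}.ncard using Nat.strong_induction_on
    generalizing B with
  | _ n ih =>
    subst hn
    by_cases hne : ∃ u ∈ signVectors N, quadVal B u ≠ 0
    swap
    · push Not at hne
      exact (pairing_eq_zero hne hρ hρ1).ge
    obtain ⟨G, hG, hGB, hG0, hGρ⟩ : ∃ G : Matrix (Fin N) (Fin N) ℝ,
        (∀ u ∈ signVectors N, 0 ≤ quadVal G u) ∧
        (∀ u ∈ signVectors N, quadVal B u = 0 → quadVal G u = 0) ∧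
        (∃ u ∈ signVectors N, quadVal G u ≠ 0) ∧ 0 ≤ pairing G ρ := by
      by_cases hz : ∃ u ∈ signVectors N, quadVal B u = 0
      · obtain ⟨e, he, hze, v, hv, hve⟩ := hcover B hB hz hne
        refine ⟨Matrix.vecMulVec (fun i => (e i : ℝ)) (fun i => (e i : ℝ)) -
          (1 : ℝ) • Matrix.single i₀ i₀ 1, fun u hu => ?_, fun u hu h0 => ?_, ⟨v, hv, ?_⟩, ?_⟩
        · rw [quadVal_matheron i₀ e hu, sub_nonneg]
          exact one_le_sq_sum_of_odd hu (odd_sum_of_mem_matheronVectors he)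
        · rw [quadVal_matheron i₀ e hu, hze u hu h0, sub_self]
        · rwa [quadVal_matheron i₀ e hv, sub_ne_zero]
        · rw [pairing_sub_smul, pairing_single, hρ1, pairing_vecMulVec_left, mul_one, sub_nonneg]
          exact hρe e he
      · push Not at hz
        refine ⟨Matrix.single i₀ i₀ 1, fun u hu => ?_, fun u hu h0 => absurd h0 (hz u hu),
          ⟨1, one_mem_signVectors N, ?_⟩, ?_⟩
        · rw [quadVal_single i₀ hu]; exact zero_le_one
        · rw [quadVal_single i₀ (one_mem_signVectors N)]; exact one_ne_zero
        · rw [pairing_single, hρ1]; exact zero_le_one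
    obtain ⟨t, ht, hB', hlt⟩ := exists_sub_smul hB hG hGB hG0
    have := ih _ hlt hB' rfl
    rw [pairing_sub_smul] at this
    nlinarith

/-! ### Affine functions of the supra-diagonal entries as quadratic forms -/

theorem sum_upperPair (g : Fin N → Fin N → ℝ) :
    ∑ p : UpperPair N, g p.1.1 p.1.2 = ∑ i, ∑ j, if i < j then g i j else 0 := by
  rw [← Fintype.sum_prod_type' (f := fun i j => if i < j then g i j else 0),
    ← Finset.sum_filter]
  exact (Finset.sum_subtype (Finset.univ.filter fun p : Fin N × Fin N => p.1 < p.2)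
    (p := fun p => p.1 < p.2) (by simp) fun p => g p.1 p.2).symm

theorem sum_sum_eq_diag_add (g : Fin N → Fin N → ℝ) (hg : ∀ i j, g i j = g j i) :
    ∑ i, ∑ j, g i j = ∑ i, g i i + 2 * ∑ p : UpperPair N, g p.1.1 p.1.2 := by
  have h1 : ∑ i, ∑ j, (if j < i then g i j else 0) = ∑ i, ∑ j, if i < j then g i j else 0 := by
    rw [Finset.sum_comm]
    exact Finset.sum_congr rfl fun i _ => Finset.sum_congr rfl fun j _ => by rw [hg j i]
  have h2 : ∑ i, ∑ j, (if i = j then g i j else 0) = ∑ i, g i i := by simp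
  rw [sum_upperPair, two_mul, ← h2]
  nth_rewrite 2 [← h1]
  simp only [← Finset.sum_add_distrib]
  refine Finset.sum_congr rfl fun i _ => Finset.sum_congr rfl fun j _ => ?_
  rcases lt_trichotomy i j with h | h | h
  · simp [h, h.ne, h.not_gt]
  · simp [h]
  · simp [h, h.ne', h.not_gt]

/-- A matrix whose quadratic form takes the value `o - ⟨triProd u, μ⟩` at sign vectors `u`. -/
def affineMatrix (i₀ : Fin N) (o : ℝ) (μ : TriArray N) : Matrix (Fin N) (Fin N) ℝ :=
  (Matrix.of fun i j => if h : i < j then -μ ⟨(i, j), h⟩ else 0) - (-o) • Matrix.single i₀ i₀ 1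

theorem pairing_affineMatrix (i₀ : Fin N) (o : ℝ) (μ : TriArray N)
    (ρ : Matrix (Fin N) (Fin N) ℝ) :
    pairing (affineMatrix i₀ o μ) ρ = o * ρ i₀ i₀ - supraDiag ρ ⬝ᵥ μ := by
  have h : supraDiag ρ ⬝ᵥ μ = ∑ p : UpperPair N,
      ρ p.1.1 p.1.2 * (if h : p.1.1 < p.1.2 then μ ⟨(p.1.1, p.1.2), h⟩ else 0) :=
    Finset.sum_congr rfl fun p _ => by rw [dif_pos p.2]; rfl
  rw [affineMatrix, pairing_sub_smul, pairing_single, h,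
    sum_upperPair fun i j => ρ i j * (if h : i < j then μ ⟨(i, j), h⟩ else 0)]
  have h' : pairing (Matrix.of fun i j => if h : i < j then -μ ⟨(i, j), h⟩ else 0) ρ =
      -∑ i, ∑ j, if i < j then ρ i j * (if h : i < j then μ ⟨(i, j), h⟩ else 0) else 0 := by
    simp only [pairing, Matrix.of_apply, ← Finset.sum_neg_distrib]
    refine Finset.sum_congr rfl fun i _ => Finset.sum_congr rfl fun j _ => ?_
    by_cases hij : i < j
    · simp only [hij, dite_true, if_true]; ring
    · simp [hij]
  rw [h']
  ring

theorem quadVal_affineMatrix (i₀ : Fin N) (o : ℝ) (μ : TriArray N) {u : Fin N → ℝ}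
    (hu : u ∈ signVectors N) :
    quadVal (affineMatrix i₀ o μ) u = o - triProd u ⬝ᵥ μ := by
  rw [← pairing_vecMulVec, pairing_affineMatrix, Matrix.vecMulVec_apply, ← sq,
    sq_eq_one_of_mem_signVectors hu, mul_one]
  rfl

theorem eq_zero_of_quadVal_affineMatrix {i₀ : Fin N} {o : ℝ} {μ : TriArray N}
    (h : ∀ u ∈ signVectors N, quadVal (affineMatrix i₀ o μ) u = 0) : μ = 0 := by
  ext ⟨⟨i, j⟩, hij⟩
  have hij : i < j := hij
  have := add_transpose_eq_zero h hij.ne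
  have h1 : ¬ (i₀ = i ∧ i₀ = j) := fun h => hij.ne (h.1.symm.trans h.2)
  have h2 : ¬ (i₀ = j ∧ i₀ = i) := fun h => h1 h.symm
  simpa [affineMatrix, Matrix.single_apply, hij, hij.not_gt, h1, h2] using this

end Pairing

/-! ### Unit covariances -/

section UnitCovariances

variable {N : ℕ}

theorem IsUnitField.integrable_mul {Ω : Type*} [MeasurableSpace Ω] {P : Measure Ω}
    [IsFiniteMeasure P] {X : Ω → Fin N → ℝ} (hX : IsUnitField X) (i j : Fin N) :
    Integrable (fun ω => X ω i * X ω j) P := by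
  have hi : Measurable fun ω => X ω i := (measurable_pi_apply i).comp hX.measurable
  have hj : Measurable fun ω => X ω j := (measurable_pi_apply j).comp hX.measurable
  refine Integrable.of_bound (hi.mul hj).aestronglyMeasurable 1 (ae_of_all _ fun ω => ?_)
  rcases hX.mem_signVectors ω i with h | h <;> rcases hX.mem_signVectors ω j with h' | h' <;>
    simp [h, h']

theorem quadVal_eq_sum_mul (B : Matrix (Fin N) (Fin N) ℝ) (u : Fin N → ℝ) :
    quadVal B u = ∑ i, ∑ j, B i j * (u i * u j) := by
  simp only [quadVal, mul_assoc]

theorem IsUnitField.integrable_quadVal {Ω : Type*} [MeasurableSpace Ω] {P : Measure Ω}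
    [IsFiniteMeasure P] {X : Ω → Fin N → ℝ} (hX : IsUnitField X)
    (B : Matrix (Fin N) (Fin N) ℝ) : Integrable (fun ω => quadVal B (X ω)) P := by
  simp only [quadVal_eq_sum_mul]
  exact integrable_finsetSum _ fun i _ => integrable_finsetSum _ fun j _ =>
    (hX.integrable_mul i j).const_mul _

theorem IsUnitField.integral_quadVal {Ω : Type*} [MeasurableSpace Ω] {P : Measure Ω}
    [IsFiniteMeasure P] {X : Ω → Fin N → ℝ} (hX : IsUnitField X)
    (B : Matrix (Fin N) (Fin N) ℝ) {ρ : Matrix (Fin N) (Fin N) ℝ}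
    (hρ : ∀ i j, ρ i j = ∫ ω, X ω i * X ω j ∂P) :
    ∫ ω, quadVal B (X ω) ∂P = pairing B ρ := by
  have hint : ∀ i j, Integrable (fun ω => B i j * (X ω i * X ω j)) P := fun i j =>
    (hX.integrable_mul i j).const_mul _
  simp only [quadVal_eq_sum_mul, pairing, hρ]
  refine (integral_finsetSum _ fun i _ => integrable_finsetSum _ fun j _ => hint i j).trans
    (Finset.sum_congr rfl fun i _ => ?_)
  refine (integral_finsetSum _ fun j _ => hint i j).trans (Finset.sum_congr rfl fun j _ => ?_)
  exact integral_const_mul _ _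

theorem isSymm_of_mem_unitCovariances {ρ : Matrix (Fin N) (Fin N) ℝ}
    (hρ : ρ ∈ unitCovariances N) : ρ.IsSymm := by
  obtain ⟨Ω, _, P, X, _, -, h⟩ := hρ
  ext i j
  rw [Matrix.transpose_apply, h, h]
  simp only [mul_comm]

theorem diag_of_mem_unitCovariances {ρ : Matrix (Fin N) (Fin N) ℝ}
    (hρ : ρ ∈ unitCovariances N) (i : Fin N) : ρ i i = 1 := by
  obtain ⟨Ω, _, P, X, _, hX, h⟩ := hρ
  simp [h, ← sq, sq_eq_one_of_mem_signVectors (hX.mem_signVectors _)]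

theorem matheronIneq_of_odd {ρ : Matrix (Fin N) (Fin N) ℝ} (hρ : ρ ∈ unitCovariances N)
    {e : Fin N → ℤ} (he : Odd (∑ i, e i)) : MatheronIneq ρ e := by
  obtain ⟨Ω, _, P, X, _, hX, h⟩ := hρ
  rw [MatheronIneq, ← pairing_vecMulVec_left (fun i => (e i : ℝ)), ← hX.integral_quadVal _ h]
  calc (1 : ℝ) = ∫ _, (1 : ℝ) ∂P := by simp
    _ ≤ _ := integral_mono (integrable_const 1) (hX.integrable_quadVal _) fun ω => by
      simp only [quadVal_vecMulVec]
      exact one_le_sq_sum_of_odd (hX.mem_signVectors ω) he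

/-- The weights of a convex combination serve as the law of a random index that selects one of the
sign vectors. -/
theorem mem_unitCovariances_of_mem_convexHull {ρ : Matrix (Fin N) (Fin N) ℝ} (hρ : ρ.IsSymm)
    (hρ1 : ∀ i, ρ i i = 1) (h : supraDiag ρ ∈ convexHull ℝ (triProd '' signVectors N)) :
    ρ ∈ unitCovariances N := by
  obtain ⟨ι, _, w, z, hw, hw1, hz, hsum⟩ := mem_convexHull_iff_exists_fintype.1 h
  choose v hv hvz using hz
  let p : PMF ι := PMF.ofFintype (fun i => ENNReal.ofReal (w i)) (by
    rw [← ENNReal.ofReal_sum_of_nonneg fun i _ => hw i, hw1, ENNReal.ofReal_one])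
  let _ : MeasurableSpace ι := ⊤
  refine ⟨ι, ⊤, p.toMeasure, v, inferInstance, ⟨measurable_from_top, hv⟩, fun i j => ?_⟩
  have hint : ∫ a, v a i * v a j ∂p.toMeasure = ∑ a, w a * (v a i * v a j) := by
    rw [PMF.integral_eq_sum]
    refine Finset.sum_congr rfl fun a _ => ?_
    rw [PMF.ofFintype_apply, ENNReal.toReal_ofReal (hw a), smul_eq_mul]
  rw [hint]
  have key : ∀ i j : Fin N, i < j → ρ i j = ∑ a, w a * (v a i * v a j) := fun i j hij => by
    have := congrFun hsum ⟨(i, j), hij⟩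
    simp only [← hvz, Finset.sum_apply, Pi.smul_apply, smul_eq_mul, triProd, supraDiag,
      Matrix.vecMulVec_apply] at this
    exact this.symm
  rcases lt_trichotomy i j with hij | rfl | hij
  · exact key i j hij
  · simp only [← sq, sq_eq_one_of_mem_signVectors (hv _), mul_one, hw1, hρ1]
  · rw [← hρ.apply, key j i hij]
    simp only [mul_comm (v _ i)]

theorem triProd_mem_unitPolytope {u : Fin N → ℝ} (hu : u ∈ signVectors N) :
    triProd u ∈ unitPolytope N := by
  refine ⟨Matrix.vecMulVec u u, mem_unitCovariances_of_mem_convexHull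
    (Matrix.transpose_vecMulVec _ _) (fun i => ?_) (subset_convexHull _ _ ⟨u, hu, rfl⟩), rfl⟩
  rw [Matrix.vecMulVec_apply, ← sq, sq_eq_one_of_mem_signVectors hu]

theorem mem_unitCovariances_of_matheronIneq (hN : 1 ≤ N) (hcover : HasZeroCover N)
    {ρ : Matrix (Fin N) (Fin N) ℝ} (hρ : ρ.IsSymm) (hρ1 : ∀ i, ρ i i = 1)
    (hρe : ∀ e ∈ matheronVectors N, MatheronIneq ρ e) : ρ ∈ unitCovariances N := by
  refine mem_unitCovariances_of_mem_convexHull hρ hρ1 ?_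
  by_contra hmem
  obtain ⟨f, o, hlt, hgt⟩ := geometric_hahn_banach_closed_point
    (convex_convexHull ℝ (triProd '' signVectors N))
    (((signVectors_finite N).image _).isClosed_convexHull (𝕜 := ℝ)) hmem
  have hf : ∀ x : TriArray N, f x = x ⬝ᵥ fun p => f (Pi.single p 1) := fun x => by
    have := LinearMap.pi_apply_eq_sum_univ f.toLinearMap x
    simp only [ContinuousLinearMap.coe_coe, smul_eq_mul] at this
    rw [this]
    refine Finset.sum_congr rfl fun p _ => ?_
    congr 2
    ext q
    simp [Pi.single_apply, eq_comm]
  have := pairing_nonneg hN hcover hρ hρ1 hρe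
    (B := affineMatrix ⟨0, hN⟩ o fun p => f (Pi.single p 1)) fun u hu => by
      rw [quadVal_affineMatrix _ _ _ hu, ← hf]
      exact sub_nonneg.2 (hlt _ (subset_convexHull _ _ ⟨u, hu, rfl⟩)).le
  rw [pairing_affineMatrix, hρ1, mul_one, ← hf] at this
  linarith

/-! ### Facets -/

/-- Pairing with `μ` as a linear functional. -/
def dotFunctional {ι : Type*} [Fintype ι] (μ : ι → ℝ) : (ι → ℝ) →ₗ[ℝ] ℝ where
  toFun x := x ⬝ᵥ μ
  map_add' x y := add_dotProduct x y μ
  map_smul' c x := smul_dotProduct c x μ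

theorem vectorSpan_le_ker_dotFunctional {ι : Type*} [Fintype ι] {μ : ι → ℝ} {c : ℝ}
    {F : Set (ι → ℝ)} (h : ∀ x ∈ F, x ⬝ᵥ μ = c) :
    vectorSpan ℝ F ≤ LinearMap.ker (dotFunctional μ) := by
  rw [vectorSpan_def, Submodule.span_le]
  rintro _ ⟨x, hx, y, hy, rfl⟩
  change (x - y) ⬝ᵥ μ = 0
  rw [sub_dotProduct, h x hx, h y hy, sub_self]

/-- By dimension the direction of `F` is the whole hyperplane orthogonal to `μ`. Since `a` is also
orthogonal to it, `a` is a multiple of `μ`. -/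
theorem exists_eq_smul_of_facet {ι : Type*} [Fintype ι] {μ a : ι → ℝ} (hμ : μ ≠ 0) {c d : ℝ}
    {F : Set (ι → ℝ)} (hF : Module.finrank ℝ (vectorSpan ℝ F) + 1 = Fintype.card ι)
    (hc : ∀ x ∈ F, x ⬝ᵥ μ = c) (hd : ∀ x ∈ F, x ⬝ᵥ a = d) : ∃ t : ℝ, a = t • μ := by
  classical
  have hμμ : μ ⬝ᵥ μ ≠ 0 := fun h => hμ (dotProduct_self_eq_zero.1 h)
  have hsurj : LinearMap.range (dotFunctional μ) = ⊤ := by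
    rw [LinearMap.range_eq_top]
    intro r
    refine ⟨(r / (μ ⬝ᵥ μ)) • μ, ?_⟩
    change ((r / (μ ⬝ᵥ μ)) • μ) ⬝ᵥ μ = r
    rw [smul_dotProduct, smul_eq_mul, div_mul_cancel₀ _ hμμ]
  have hrank := LinearMap.finrank_range_add_finrank_ker (dotFunctional μ)
  rw [hsurj, finrank_top, Module.finrank_self, Module.finrank_fintype_fun_eq_card] at hrank
  have hker : vectorSpan ℝ F = LinearMap.ker (dotFunctional μ) :=
    Submodule.eq_of_le_of_finrank_eq (vectorSpan_le_ker_dotFunctional hc) (by omega)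
  have hle := vectorSpan_le_ker_dotFunctional hd
  rw [hker] at hle
  refine ⟨(μ ⬝ᵥ a) / (μ ⬝ᵥ μ), ?_⟩
  ext i
  have hmem : Pi.single i 1 - (μ i / (μ ⬝ᵥ μ)) • μ ∈ LinearMap.ker (dotFunctional μ) := by
    change (Pi.single i 1 - (μ i / (μ ⬝ᵥ μ)) • μ) ⬝ᵥ μ = 0
    rw [sub_dotProduct, smul_dotProduct, smul_eq_mul, div_mul_cancel₀ _ hμμ,
      single_dotProduct, one_mul, sub_self]
  have h : (Pi.single i 1 - (μ i / (μ ⬝ᵥ μ)) • μ) ⬝ᵥ a = 0 := hle hmem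
  rw [sub_dotProduct, smul_dotProduct, smul_eq_mul, single_dotProduct, one_mul] at h
  rw [Pi.smul_apply, smul_eq_mul]
  linear_combination h

theorem sum_sum_eq_sum_sq_add {ρ : Matrix (Fin N) (Fin N) ℝ} (hρ : ρ.IsSymm)
    (hρ1 : ∀ i, ρ i i = 1) (a : Fin N → ℝ) :
    pairing (Matrix.vecMulVec a a) ρ = ∑ i, a i ^ 2 + 2 * (supraDiag ρ ⬝ᵥ triProd a) := by
  rw [pairing_vecMulVec_left, sum_sum_eq_diag_add (fun i j => ρ i j * a i * a j) fun i j => by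
    rw [← hρ.apply i j]; ring]
  congr 1
  · exact Finset.sum_congr rfl fun i _ => by rw [hρ1]; ring
  · congr 1
    exact Finset.sum_congr rfl fun p _ => by
      simp only [supraDiag, triProd, Matrix.vecMulVec_apply]; ring

theorem exists_of_isFacetOuterNormal (hN : 1 ≤ N) (hcover : HasZeroCover N) {μ : TriArray N}
    (hμ : IsFacetOuterNormal (unitPolytope N) μ) :
    ∃ e ∈ matheronVectors N, ∃ c : ℝ, 0 < c ∧ μ = -(c • triProd (fun i => (e i : ℝ))) := by
  obtain ⟨hμ0, o, hle, ⟨x₀, hx₀, hx₀o⟩, hrank⟩ := hμ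
  let i₀ : Fin N := ⟨0, hN⟩
  have hB : ∀ u ∈ signVectors N, 0 ≤ quadVal (affineMatrix i₀ o μ) u := fun u hu => by
    rw [quadVal_affineMatrix _ _ _ hu, sub_nonneg]
    exact hle _ (triProd_mem_unitPolytope hu)
  -- On the face a nonnegative variable has mean zero, so the unit field almost surely takes values
  -- in the zero set of the form.
  have hface : ∀ {Ω : Type} [MeasurableSpace Ω] {P : Measure Ω} [IsProbabilityMeasure P]
      {X : Ω → Fin N → ℝ} (_ : IsUnitField X) {ρ : Matrix (Fin N) (Fin N) ℝ}
      (_ : ∀ i j, ρ i j = ∫ ω, X ω i * X ω j ∂P) (_ : ρ i₀ i₀ = 1)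
      (_ : supraDiag ρ ⬝ᵥ μ = o), ∀ᵐ ω ∂P, quadVal (affineMatrix i₀ o μ) (X ω) = 0 := by
    intro Ω _ P _ X hX ρ hρ hρ1 hρo
    have := hX.integral_quadVal (affineMatrix i₀ o μ) hρ
    rw [pairing_affineMatrix, hρ1, hρo, mul_one, sub_self] at this
    exact (integral_eq_zero_iff_of_nonneg (fun ω => hB _ (hX.mem_signVectors ω))
      (hX.integrable_quadVal _)).1 this
  have hz : ∃ u ∈ signVectors N, quadVal (affineMatrix i₀ o μ) u = 0 := by
    obtain ⟨ρ, hρ, rfl⟩ := hx₀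
    have hρ1 := diag_of_mem_unitCovariances hρ i₀
    obtain ⟨Ω, _, P, X, _, hX, h⟩ := hρ
    obtain ⟨ω, hω⟩ := (hface hX h hρ1 hx₀o).exists
    exact ⟨X ω, hX.mem_signVectors ω, hω⟩
  have hne : ∃ u ∈ signVectors N, quadVal (affineMatrix i₀ o μ) u ≠ 0 := by
    by_contra h
    push Not at h
    exact hμ0 (eq_zero_of_quadVal_affineMatrix h)
  obtain ⟨e, he, hze, v, hv, hve⟩ := hcover _ hB hz hne
  set a : TriArray N := triProd (fun i => (e i : ℝ)) with ha
  -- On the face `(e · X)² = 1` almost surely; expanding the mean of the square with unit diagonal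
  -- gives the constant.
  have hd : ∀ x ∈ {x ∈ unitPolytope N | x ⬝ᵥ μ = o},
      x ⬝ᵥ a = (1 - ∑ i, (e i : ℝ) ^ 2) / 2 := by
    rintro _ ⟨⟨ρ, hρ, rfl⟩, hρo⟩
    have hρ1 := diag_of_mem_unitCovariances hρ
    have hsum := sum_sum_eq_sum_sq_add (isSymm_of_mem_unitCovariances hρ) hρ1 fun i => (e i : ℝ)
    obtain ⟨Ω, _, P, X, _, hX, h⟩ := hρ
    have hae : ∀ᵐ ω ∂P, quadVal (Matrix.vecMulVec (fun i => (e i : ℝ)) fun i => (e i : ℝ)) (X ω) =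
        1 := by
      filter_upwards [hface hX h (hρ1 i₀) hρo] with ω hω
      rw [quadVal_vecMulVec]
      exact hze _ (hX.mem_signVectors ω) hω
    rw [← hX.integral_quadVal _ h, integral_congr_ae hae, integral_const, probReal_univ,
      one_smul] at hsum
    linarith
  rw [direction_affineSpan] at hrank
  obtain ⟨t, hat⟩ := exists_eq_smul_of_facet hμ0 hrank (fun x hx => hx.2) hd
  have hx₀a := hd x₀ ⟨hx₀, hx₀o⟩
  have hv1 : (∑ i, v i * (e i : ℝ)) ^ 2 - 1 = 2 * t * (triProd v ⬝ᵥ μ - o) := by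
    have h1 := sum_sum_eq_sum_sq_add (ρ := Matrix.vecMulVec v v) (Matrix.transpose_vecMulVec _ _)
      (fun i => by rw [Matrix.vecMulVec_apply, ← sq, sq_eq_one_of_mem_signVectors hv])
      fun i => (e i : ℝ)
    rw [pairing_vecMulVec, quadVal_vecMulVec] at h1
    change _ = _ + 2 * (triProd v ⬝ᵥ a) at h1
    rw [hat, dotProduct_smul, smul_eq_mul] at h1 hx₀a
    rw [hx₀o] at hx₀a
    linear_combination h1 + 2 * hx₀a
  have hv2 := one_le_sq_sum_of_odd hv (odd_sum_of_mem_matheronVectors he)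
  have hv3 := hle _ (triProd_mem_unitPolytope hv)
  -- At `v` the left side of `hv1` is positive, while `⟨v ⊘ v, μ⟩ ≤ o`; this fixes the sign.
  have ht : t < 0 := by
    by_contra ht
    push Not at ht
    exact hve (le_antisymm (by nlinarith) hv2)
  refine ⟨e, he, -t⁻¹, by simpa using ht, ?_⟩
  rw [← ha, hat, smul_smul, neg_mul, inv_mul_cancel₀ ht.ne, neg_one_smul, neg_neg]

end UnitCovariances

theorem mainTheorem1 (N : ℕ) (hN : 1 ≤ N) :
    (N ≤ 6 →
      (∀ μ : TriArray N, IsFacetOuterNormal (unitPolytope N) μ →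
        ∃ e ∈ matheronVectors N, ∃ c : ℝ, 0 < c ∧ μ = -(c • triProd (fun i => (e i : ℝ)))) ∧
      (∀ ρ : Matrix (Fin N) (Fin N) ℝ, ρ.IsSymm → (∀ i, ρ i i = 1) →
        (ρ ∈ unitCovariances N ↔ ∀ e ∈ matheronVectors N, MatheronIneq ρ e))) ∧
    (∀ ρ ∈ unitCovariances N, ∀ e : Fin N → ℤ, Odd (∑ i, e i) → MatheronIneq ρ e) := by
  refine ⟨fun hN6 => ⟨fun μ hμ => ?_, fun ρ hρ hρ1 => ⟨fun h e he => ?_, fun h => ?_⟩⟩,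
    fun ρ hρ e he => matheronIneq_of_odd hρ he⟩
  · exact exists_of_isFacetOuterNormal hN (hasZeroCover hN hN6) hμ
  · exact matheronIneq_of_odd h (odd_sum_of_mem_matheronVectors he)
  · exact mem_unitCovariances_of_matheronIneq hN (hasZeroCover hN hN6) hρ hρ1 h
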